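/- **Bellman–Ford.** A *Bellman–Ford instance* is a finite undirected graph $G$ with vertex labels $a_G(v)\ge 0$ and edge weights $w_G(e)\ge 0$. Write $N(v)$ for the closed neighbourhood of $v$ (the neighbours of $v$ together with $v$ itself) and put $w_G(v,v)=0$. The $t$-step Bellman–Ford distance $x_v^{(t)}$ is defined by $x_v^{(0)}=a_G(v)$ and $x_v^{(t)}=\min_{u\in N(v)}\bigl(x_u^{(t-1)}+w_G(u,v)\bigr)$. **Network.** Let $K,m,d\ge 1$ be integers, $J=2mK$, and number the layers $1,\dots,J$ so that step $t\in\{1,\dots,K\}$ consists of the aggregation layers $2m(t-1)+1,\dots,2m(t-1)+m$ followed by the update layers $2m(t-1)+m+1,\dots,2mt$. Let $d_j=1$ if $j=0$, $j=J$, or $j$ is the last aggregation layer $2m(t-1)+m$ of some step $t$, and $d_j=d$ otherwise. Let $j_0=0$ and let $j_k=2m(k-1)+1$ be the first aggregation layer of step $k$, $1\le k\le K$. The parameters $\theta$ are arbitrary real matrices $W^j\in\mathbb R^{d_j\times d_{j-1}}$ and vectors $b^j\in\mathbb R^{d_j}$ ($1\le j\le J$) and vectors $C^k\in\mathbb R^{d_{j_k}}$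 ($1\le k\le K$). On a Bellman–Ford instance $G$ set $h_v^{(0)}=a_G(v)$ and, for $t=1,\dots,K$, $$h_v^{(t)}=\mathrm{UPD}^{(t)}\Bigl(\min_{u\in N(v)}\mathrm{AGG}^{(t)}\bigl(h_u^{(t-1)},w_G(v,u)\bigr)\Bigr),$$ where $\mathrm{AGG}^{(t)}$ and $\mathrm{UPD}^{(t)}$ are the $m$-layer ReLU networks formed by the aggregation and update layers of step $t$: layer $j$ is $y\mapsto\sigma(W^jy+b^j)$ with $\sigma=\max(0,\cdot)$ componentwise, except that the first aggregation layer of step $t$ is $(y,w)\mapsto\sigma(W^{j_t}y+C^tw+b^{j_t})$. In particular the aggregated value is one-dimensional and $h_v^{(K)}\in\mathbb R$. **Loss.** Let $X$ be a finite set of pairs $(G,v)$ with $G$ a Bellman–Ford instance and $v\in V(G)$, let $N=|X|$, and let $\eta$ be a real number. With $\|\cdot\|_1$ the sum of the absolute values of the entries, put $$\mathcal L(\theta)=\frac1N\sum_{(G,v)\in X}\bigl|h_v^{(K)}-x_v^{(K)}\bigr|+\eta\Bigl(\sum_{k=0}^{K}\sum_{j=j_k+1}^{J}\|W^j\|_1+\sum_{k=1}^K\|C^k\|_1+\sum_{j=1}^J\|b^j\|_1\Bigr).$$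 **Training set.** For $z=(z_0,\dots,z_K)$ with nonnegative entries and $\beta>0$, let $P_\beta(z)$ be the path with vertices $v_0,\dots,v_K$ and edges $v_{i-1}v_i$ of weight $z_i$ ($1\le i\le K$), where $v_0$ has label $z_0$ and $v_1,\dots,v_K$ have label $\beta$. For $x\ge 0$ let $T_{S_{x,K}}$ consist of the $K+1$ pairs $(P_\beta(x e_k),v_K)$, $0\le k\le K$, where $e_0,\dots,e_K$ is the standard basis of $\mathbb R^{K+1}$. **Theorem.** Assume that $\eta\ge 2K\exp\bigl(m(K^2+3K)\bigr)$, that $x\ge 4mKN\eta$, that $\beta\ge 2(N+x+1)$, and that $T_{S_{x,K}}\subseteq X$. Let $\varepsilon\le\frac12$ and let $\theta$ be parameters with $\mathcal L(\theta)\le\inf_{\theta'}\mathcal L(\theta')+\varepsilon$. Then for every Bellman–Ford instance $G$ and every vertex $v\in V(G)$, $$\bigl|h_v^{(K)}-x_v^{(K)}\bigr|\le\varepsilon\,\bigl(x_v^{(K)}+1\bigr).$$ -/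

import Mathlib

open scoped NNReal

universe u

namespace BFLearning

/-! ### Bellman-Ford instances and the Bellman-Ford update -/

/-- A Bellman-Ford instance: a finite undirected graph with nonnegative real vertex labels and
nonnegative real edge weights. -/
structure BFInstance : Type (u + 1) where
  /-- the vertices -/
  V : Type u
  [fintypeV : Fintype V]
  /-- the edges -/
  graph : SimpleGraph V
  /-- the vertex labels -/
  label : V → ℝ≥0
  /-- the edge weights -/
  edgeWeight : graph.edgeSet → ℝ≥0

attribute [instance] BFInstance.fintypeV

namespace BFInstance

open scoped Classical in
/-- The closed neighbourhood `N(v) ∪ {v}`. -/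
noncomputable def nbrs (G : BFInstance.{u}) (v : G.V) : Finset G.V :=
  Finset.univ.filter fun u => u = v ∨ G.graph.Adj v u

theorem nbrs_nonempty (G : BFInstance.{u}) (v : G.V) : (G.nbrs v).Nonempty :=
  ⟨v, by simp [nbrs]⟩

open scoped Classical in
/-- The weight `w(u, v)` of a pair of vertices `u ∈ N(v) ∪ {v}`: the weight of the edge `uv`, and
`w(v, v) = 0`. (On all other pairs, where it is never used, the value is `0` as well.) -/
noncomputable def weight (G : BFInstance.{u}) (u v : G.V) : ℝ≥0 :=
  if h : G.graph.Adj u v then G.edgeWeight ⟨s(u, v), h⟩ else 0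

/-- The Bellman-Ford update `Γ`: same graph, same edge weights, and the new label of `v` is
`min {a(u) + w(u, v) : u ∈ N(v) ∪ {v}}`. -/
noncomputable abbrev update (G : BFInstance.{u}) : BFInstance.{u} where
  V := G.V
  graph := G.graph
  label v := (G.nbrs v).inf' (G.nbrs_nonempty v) fun u => G.label u + G.weight u v
  edgeWeight := G.edgeWeight

/-- The label of `v` in the `t`-fold Bellman-Ford update of `G`, i.e. the `t`-step Bellman-Ford
distance `x_v^(t)` of `v`. -/
noncomputable def dist : (t : ℕ) → (G : BFInstance.{u}) → G.V → ℝ≥0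
  | 0, G => G.label
  | t + 1, G => dist t G.update

end BFInstance

/-- The set `V₁(𝒢)` of pairs of a Bellman-Ford instance and one of its vertices. -/
abbrev VertexInstance : Type (u + 1) := Σ G : BFInstance.{u}, G.V

/-! ### The path training set -/

/-- The path `P_β(z)` with vertices `v_0, …, v_K` and edges `v_{i-1} v_i`: the label of `v_0` is
`z_0`, all other labels are `β`, and the edge `v_{i-1} v_i` has weight `z_i`, `i = 1, …, K`.
(For an edge `e`, the larger one of its end points is `e.sup`.) -/
def pathInstance (K : ℕ) (β : ℝ≥0) (z : Fin (K + 1) → ℝ≥0) : BFInstance.{0} where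
  V := Fin (K + 1)
  graph := SimpleGraph.pathGraph (K + 1)
  label i := if i = 0 then z 0 else β
  edgeWeight e := z (e : Sym2 (Fin (K + 1))).sup

/-- The path training set `T_{S_{x,K}}`: the end vertices `v_K` of the `K + 1` paths `P_β(x e_k)`,
where `e_0, …, e_K` are the unit vectors. -/
def pathTrainingSet (K : ℕ) (β x : ℝ≥0) : Set VertexInstance.{0} :=
  Set.range fun k : Fin (K + 1) => ⟨pathInstance K β (Pi.single k x), Fin.last K⟩

/-! ### The architecture

The network has `J = 2 m K` global layers: for each of the `K` message-passing steps there are `m`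
layers of an aggregation FNN followed by `m` layers of an update FNN. -/

/-- The number `2 m t` of global layers that precede message-passing step `t + 1`. The layers of
that step are the aggregation layers `layerStart m t + 1, …, layerStart m t + m` and the update
layers `layerStart m t + m + 1, …, layerStart m t + m + m`. -/
def layerStart (m : ℕ) : ℕ → ℕ
  | 0 => 0
  | t + 1 => layerStart m t + m + m

theorem layerStart_eq (m t : ℕ) : layerStart m t = 2 * m * t := by
  induction t with
  | zero => rfl
  | succ t ih => rw [layerStart, ih]; ring

theorem layerStart_succ_le {m K t : ℕ} (ht : t + 1 ≤ K) :
    layerStart m t + m + m ≤ 2 * m * K := by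
  have h : layerStart m (t + 1) ≤ 2 * m * K := by
    rw [layerStart_eq]; exact Nat.mul_le_mul_left _ ht
  exact h

/-- The dimension `d_j` of the features after global layer `j`: it is `1` for the input `j = 0`, for
the output `j = J` and for the last layer of each aggregation FNN, and the hidden dimension `d`
otherwise. -/
def dim (m K d j : ℕ) : ℕ :=
  if j = 0 ∨ j = 2 * m * K ∨ ∃ t < K, j = layerStart m t + m then 1 else d

theorem dim_layerStart_last (m K d : ℕ) : dim m K d (layerStart m K) = 1 := by
  simp [dim, layerStart_eq]

/-- The parameters: weight matrices `W^1, …, W^J` acting on the vertex features, vectors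
`C^1, …, C^K` acting on the edge weights in the first layer of each aggregation FNN, and bias
vectors `b^1, …, b^J`. All indices are shifted to start at `0`. -/
structure Params (m K d : ℕ) where
  W : (j : Fin (2 * m * K)) → Matrix (Fin (dim m K d (j + 1))) (Fin (dim m K d j)) ℝ
  C : (k : Fin K) → Fin (dim m K d (layerStart m k + 1)) → ℝ
  b : (j : Fin (2 * m * K)) → Fin (dim m K d (j + 1)) → ℝ

/-- The rectified linear unit, applied componentwise. -/
def relu {n : ℕ} (y : Fin n → ℝ) : Fin n → ℝ := fun i => max 0 (y i)

variable {m K d : ℕ}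

/-- The ReLU FNN formed by the `n` global layers `s + 1, …, s + n`, where the vector `e` is added
before the activation in the first of these layers. For `e = 0` this is
`x ↦ σ(W^{s+n} ⋯ σ(W^{s+1} x + b^{s+1}) ⋯ + b^{s+n})`; for an aggregation FNN, whose first layer acts
on the concatenation of the feature `x` and the edge weight `w` by the matrix `(W^{s+1} | C)`, one
takes `e = w C`. -/
def fnn (θ : Params m K d) (s : ℕ) (e : Fin (dim m K d (s + 1)) → ℝ) :
    (n : ℕ) → s + n ≤ 2 * m * K → (Fin (dim m K d s) → ℝ) → Fin (dim m K d (s + n)) → ℝ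
  | 0, _, x => x
  | 1, h, x => relu ((θ.W ⟨s, h⟩).mulVec x + e + θ.b ⟨s, h⟩)
  | n + 2, h, x =>
      relu ((θ.W ⟨s + (n + 1), h⟩).mulVec (fnn θ s e (n + 1) (Nat.le_of_succ_le h) x)
        + θ.b ⟨s + (n + 1), h⟩)

/-- The features `h_v^(t)` of the min-aggregation MPNN: `h_v^(0) = a(v)`, and `h_v^(t+1)` is the
value of the update FNN of step `t + 1` at
`min {AGG(h_u^(t), w(v, u)) : u ∈ N(v) ∪ {v}}` (componentwise minimum), where `AGG` is the
aggregation FNN of step `t + 1`. -/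
noncomputable def feature (θ : Params m K d) (G : BFInstance.{u}) :
    (t : ℕ) → t ≤ K → G.V → Fin (dim m K d (layerStart m t)) → ℝ
  | 0, _, v => fun _ => (G.label v : ℝ)
  | t + 1, ht, v =>
      fnn θ (layerStart m t + m) 0 m (layerStart_succ_le ht) fun i =>
        (G.nbrs v).inf' (G.nbrs_nonempty v) fun u =>
          fnn θ (layerStart m t) ((G.weight v u : ℝ) • θ.C ⟨t, ht⟩) m
            ((Nat.le_add_right _ _).trans (layerStart_succ_le ht))
            (feature θ G t (Nat.le_of_succ_le ht) u) i

/-- The output `h_v^(K)` of the MPNN, a vector of dimension `1`, as a real number. -/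
noncomputable def output (θ : Params m K d) (G : BFInstance.{u}) (v : G.V) : ℝ :=
  feature θ G K le_rfl v ⟨0, by rw [dim_layerStart_last]; exact Nat.one_pos⟩

/-! ### The loss -/

/-- The empirical loss: the mean absolute error on the training set `X`. -/
noncomputable def empLoss (X : Finset VertexInstance.{0}) (θ : Params m K d) : ℝ :=
  (1 / (X.card : ℝ)) * ∑ p ∈ X, |output θ p.1 p.2 - (p.1.dist K p.2 : ℝ)|

/-- The index `j_k` of the first layer of the `k`-th aggregation FNN, `k = 1, …, K`, and
`j_0 = 0`. -/
def edgeLayer (m : ℕ) : ℕ → ℕ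
  | 0 => 0
  | k + 1 => layerStart m k + 1

/-- The regularizer
`∑_{k=0}^K ∑_{j=j_k+1}^J ‖W^j‖₁ + ∑_{k=1}^K ‖C^k‖₁ + ∑_{j=1}^J ‖b^j‖₁`, with entrywise `ℓ¹`-norms. -/
def regLoss (θ : Params m K d) : ℝ :=
  (∑ k ∈ Finset.range (K + 1),
      ∑ j : Fin (2 * m * K) with edgeLayer m k < j.val + 1, ∑ r, ∑ c, |θ.W j r c|)
    + (∑ k, ∑ r, |θ.C k r|) + ∑ j, ∑ r, |θ.b j r|

/-- The loss `ℒ = ℒ^emp + η ℒ^reg`. -/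
noncomputable def loss (X : Finset VertexInstance.{0}) (η : ℝ) (θ : Params m K d) : ℝ :=
  empLoss X θ + η * regLoss θ

end BFLearning

/-!
Fix a walk of length `K`, with the label of its first vertex and the weights of its steps as entries
of a vector `z ≥ 0`; the Bellman-Ford distance of the last vertex is the least entry sum of such a
vector. Along a walk the features are bounded above by a main term, obtained by replacing all
matrices by their entrywise positive parts, plus a bias term; the walk that attains the minima also
gives a lower bound. Hence the output is at most `p ⬝ᵥ z + B` for every walk, and at least
`(2 p - P) ⬝ᵥ z - B` for one of them, where `P k ≥ p k` is the product of the norms of the matrices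
and vectors through which `z k` passes. It remains to see that `p` and `P` are close to `1` and that
`B` is close to `0`.

On the path with weights `x e_k` the target is at least `x` and the output at most `p k * x + B`.
As `x` is large, each shortfall `1 - p k` is paid for by the empirical loss. As `P k ≥ p k`, the
inequality `∏ a_i ≤ exp (∑ (a_i - 1))` then bounds the sum of the norms in `P k` from below by their
number, up to that shortfall. The regularizer is the total of these sums, plus the norms of the
biases, and the number of all norms is exactly its value at parameters that compute the
Bellman-Ford distances. Almost minimal loss therefore leaves only an excess of order `ε / η` in each
sum of norms, whence `P k ≤ 1 + ε / 2` by the same inequality, and the bias term is absorbed because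
`η` exceeds every product of norms.
-/

namespace BFLearning

open scoped Matrix

variable {m K d : ℕ}

/-! ### Products and sums of nonnegative reals -/

theorem prod_le_exp_sum_sub_card {ι : Type*} (s : Finset ι) {a : ι → ℝ} (ha : ∀ i ∈ s, 0 ≤ a i) :
    ∏ i ∈ s, a i ≤ Real.exp (∑ i ∈ s, a i - s.card) := by
  have h_shift : ∑ i ∈ s, a i - (s.card : ℝ) = ∑ i ∈ s, (a i - 1) := by simp
  rw [h_shift, Real.exp_sum]
  exact Finset.prod_le_prod ha fun i _ => by linarith [Real.add_one_le_exp (a i - 1)]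

theorem card_sub_sum_le_of_le_prod {ι : Type*} (s : Finset ι) {a : ι → ℝ}
    (ha : ∀ i ∈ s, 0 ≤ a i) {p : ℝ} (hp : p ≤ ∏ i ∈ s, a i) :
    s.card - ∑ i ∈ s, a i ≤ (s.card + 1) * max 0 (1 - p) := by
  have h_max : 0 ≤ max 0 (1 - p) := le_max_left _ _
  obtain h | h := le_or_gt (s.card - ∑ i ∈ s, a i) 0
  · exact h.trans (by positivity)
  have h_exp : p ≤ Real.exp (-(s.card - ∑ i ∈ s, a i)) := by
    rw [neg_sub]
    exact hp.trans (prod_le_exp_sum_sub_card s ha)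
  have h_mul : p * (1 + (s.card - ∑ i ∈ s, a i)) ≤ 1 := by
    calc p * (1 + (s.card - ∑ i ∈ s, a i))
        ≤ Real.exp (-(s.card - ∑ i ∈ s, a i)) * Real.exp (s.card - ∑ i ∈ s, a i) := by
          gcongr
          linarith [Real.add_one_le_exp (s.card - ∑ i ∈ s, a i)]
      _ = 1 := by rw [← Real.exp_add, neg_add_cancel, Real.exp_zero]
  calc s.card - ∑ i ∈ s, a i
      ≤ (1 + (s.card - ∑ i ∈ s, a i)) * (1 - p) := by linarith
    _ ≤ (1 + (s.card - ∑ i ∈ s, a i)) * max 0 (1 - p) :=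
        mul_le_mul_of_nonneg_left (le_max_right _ _) (by linarith)
    _ ≤ (s.card + 1) * max 0 (1 - p) :=
        mul_le_mul_of_nonneg_right (by linarith [Finset.sum_nonneg ha]) h_max

theorem le_exp_half {x : ℝ} (hx : 0 ≤ x) : x ≤ Real.exp (x / 2) := by
  nlinarith [Real.quadratic_le_exp_of_nonneg (show 0 ≤ x / 2 by positivity), sq_nonneg (x - 2)]

/-! ### Matrices and entrywise norms -/

section Matrix

theorem posPart_le_abs (a : ℝ) : a⁺ ≤ |a| := sup_le (le_abs_self a) (abs_nonneg a)

theorem two_mul_posPart_sub_abs (a : ℝ) : 2 * a⁺ - |a| = a := by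
  linarith [posPart_add_negPart a, posPart_sub_negPart a]

variable {ι κ : Type*} [Fintype ι] [Fintype κ]

/-- The entrywise `ℓ¹`-norm of a matrix. -/
def matNorm (W : Matrix ι κ ℝ) : ℝ := ∑ r, ∑ c, |W r c|

/-- The `ℓ¹`-norm of a vector. -/
def vecNorm (b : ι → ℝ) : ℝ := ∑ r, |b r|

theorem matNorm_nonneg (W : Matrix ι κ ℝ) : 0 ≤ matNorm W :=
  Finset.sum_nonneg fun _ _ => Finset.sum_nonneg fun _ _ => abs_nonneg _

theorem vecNorm_nonneg (b : ι → ℝ) : 0 ≤ vecNorm b :=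
  Finset.sum_nonneg fun _ _ => abs_nonneg _

theorem sum_abs_le_matNorm (W : Matrix ι κ ℝ) (r : ι) : ∑ c, |W r c| ≤ matNorm W :=
  Finset.single_le_sum (f := fun r => ∑ c, |W r c|)
    (fun _ _ => Finset.sum_nonneg fun _ _ => abs_nonneg _) (Finset.mem_univ r)

theorem abs_le_vecNorm (b : ι → ℝ) (r : ι) : |b r| ≤ vecNorm b :=
  Finset.single_le_sum (f := fun r => |b r|) (fun _ _ => abs_nonneg _) (Finset.mem_univ r)

theorem mulVec_le_posPart_mulVec_add (W : Matrix ι κ ℝ) {y u : κ → ℝ} {B : ℝ} (hB : 0 ≤ B)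
    (hy : ∀ i, 0 ≤ y i) (hyu : ∀ i, y i ≤ u i + B) (r : ι) :
    (W *ᵥ y) r ≤ (W.map (·⁺) *ᵥ u) r + matNorm W * B := by
  have h_term (i : κ) : W r i * y i ≤ (W r i)⁺ * u i + |W r i| * B := by
    have h1 := mul_le_mul_of_nonneg_right (le_posPart (W r i)) (hy i)
    have h2 := mul_le_mul_of_nonneg_left (hyu i) (posPart_nonneg (W r i))
    have h3 := mul_le_mul_of_nonneg_right (posPart_le_abs (W r i)) hB
    linarith
  calc (W *ᵥ y) r ≤ ∑ i, ((W r i)⁺ * u i + |W r i| * B) := Finset.sum_le_sum fun i _ => h_term i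
    _ = (W.map (·⁺) *ᵥ u) r + (∑ i, |W r i|) * B := by
        rw [Finset.sum_add_distrib, ← Finset.sum_mul]; rfl
    _ ≤ (W.map (·⁺) *ᵥ u) r + matNorm W * B := by gcongr; exact sum_abs_le_matNorm W r

theorem posPart_mulVec_sub_le_mulVec (W : Matrix ι κ ℝ) {y u : κ → ℝ} {v B : ℝ} (hvB : 0 ≤ v + B)
    (huv : ∀ i, u i ≤ v) (hyu : ∀ i, y i ≤ u i + B) (huy : ∀ i, 2 * u i - v - B ≤ y i) (r : ι) :
    2 * (W.map (·⁺) *ᵥ u) r - matNorm W * (v + B) ≤ (W *ᵥ y) r := by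
  have h_term (i : κ) : 2 * ((W r i)⁺ * u i) - |W r i| * (v + B) ≤ W r i * y i := by
    obtain h | h := le_total 0 (W r i)
    · rw [posPart_of_nonneg h, abs_of_nonneg h]
      linarith [mul_le_mul_of_nonneg_left (huy i) h]
    · rw [posPart_of_nonpos h, abs_of_nonpos h]
      linarith [mul_le_mul_of_nonpos_left ((hyu i).trans (add_le_add_left (huv i) B)) h]
  calc 2 * (W.map (·⁺) *ᵥ u) r - matNorm W * (v + B)
      ≤ 2 * (W.map (·⁺) *ᵥ u) r - (∑ i, |W r i|) * (v + B) := by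
        gcongr; exact sum_abs_le_matNorm W r
    _ = ∑ i, (2 * ((W r i)⁺ * u i) - |W r i| * (v + B)) := by
        rw [Finset.sum_sub_distrib, ← Finset.mul_sum, ← Finset.sum_mul]; rfl
    _ ≤ (W *ᵥ y) r := Finset.sum_le_sum fun i _ => h_term i

theorem posPart_mulVec_le (W : Matrix ι κ ℝ) {u : κ → ℝ} {v : ℝ} (hv : 0 ≤ v)
    (hu : ∀ i, 0 ≤ u i) (huv : ∀ i, u i ≤ v) (r : ι) :
    (W.map (·⁺) *ᵥ u) r ≤ matNorm W * v := by
  calc (W.map (·⁺) *ᵥ u) r ≤ ∑ i, |W r i| * v :=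
        Finset.sum_le_sum fun i _ =>
          mul_le_mul (posPart_le_abs (W r i)) (huv i) (hu i) (abs_nonneg _)
    _ ≤ matNorm W * v := by
        rw [← Finset.sum_mul]
        exact mul_le_mul_of_nonneg_right (sum_abs_le_matNorm W r) hv

theorem posPart_mulVec_sub_colNorm_le_mulVec (E : Matrix ι κ ℝ) {z : κ → ℝ} (hz : 0 ≤ z) (r : ι) :
    2 * (E.map (·⁺) *ᵥ z) r - (fun k => vecNorm (E.col k)) ⬝ᵥ z ≤ (E *ᵥ z) r := by
  have h_term (i : κ) : 2 * ((E r i)⁺ * z i) - vecNorm (E.col i) * z i ≤ E r i * z i := by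
    have h_norm := mul_le_mul_of_nonneg_right (abs_le_vecNorm (E.col i) r) (hz i)
    calc 2 * ((E r i)⁺ * z i) - vecNorm (E.col i) * z i
        ≤ 2 * ((E r i)⁺ * z i) - |E r i| * z i := sub_le_sub_left h_norm _
      _ = (2 * (E r i)⁺ - |E r i|) * z i := by ring
      _ = E r i * z i := by rw [two_mul_posPart_sub_abs]
  calc 2 * (E.map (·⁺) *ᵥ z) r - (fun k => vecNorm (E.col k)) ⬝ᵥ z
      = ∑ i, (2 * ((E r i)⁺ * z i) - vecNorm (E.col i) * z i) := by
        rw [Finset.sum_sub_distrib, ← Finset.mul_sum]; rfl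
    _ ≤ (E *ᵥ z) r := Finset.sum_le_sum fun i _ => h_term i

end Matrix

/-! ### The layers of the network -/

theorem layerStart_lt (hm : 0 < m) (t : Fin K) : layerStart m t < 2 * m * K := by
  rw [layerStart_eq]
  gcongr
  exact t.isLt

theorem layerStart_le (t : Fin K) : layerStart m t + m ≤ 2 * m * K :=
  (Nat.le_add_right _ _).trans (layerStart_succ_le t.isLt)

theorem layerStart_injective (hm : 0 < m) : Function.Injective (layerStart m) := fun s t h => by
  simpa [layerStart_eq, hm.ne'] using h

theorem layerStart_add_ne_layerStart (s t : ℕ) {i : ℕ} (hi : 0 < i) (him : i < m + m) :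
    layerStart m s + i ≠ layerStart m t := by
  rw [layerStart_eq, layerStart_eq]
  intro h
  obtain hts | hst := le_or_gt t s
  · have := Nat.mul_le_mul_left (2 * m) hts
    omega
  · have := Nat.mul_le_mul_left (2 * m) (Nat.succ_le_of_lt hst)
    rw [Nat.succ_eq_add_one, mul_add] at this
    omega

theorem dim_aggregated (t : Fin K) : dim m K d (layerStart m t + m) = 1 :=
  if_pos (Or.inr (Or.inr ⟨t, t.isLt, rfl⟩))

theorem subsingleton_dim_aggregated (t : Fin K) :
    Subsingleton (Fin (dim m K d (layerStart m t + m))) :=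
  Fin.subsingleton_iff_le_one.2 (dim_aggregated t).le

theorem relu_nonneg {n : ℕ} (y : Fin n → ℝ) (i : Fin n) : 0 ≤ relu y i := le_max_left _ _

namespace Params

variable (θ : Params m K d)

/-- The weight matrix of layer `j + 1`, extended by `0` beyond the last layer. -/
def weightMatrix (j : ℕ) : Matrix (Fin (dim m K d (j + 1))) (Fin (dim m K d j)) ℝ :=
  if h : j < 2 * m * K then θ.W ⟨j, h⟩ else 0

/-- The bias vector of layer `j + 1`, extended by `0` beyond the last layer. -/
def biasVector (j : ℕ) : Fin (dim m K d (j + 1)) → ℝ :=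
  if h : j < 2 * m * K then θ.b ⟨j, h⟩ else 0

/-- The matrix by which the vector `z` of a walk (label of its first vertex, then the weights of
its edges) enters layer `j + 1`: the column of the edge of step `t + 1` is `C^{t+1}` in the first
aggregation layer of that step, and all other columns are zero. -/
def edgeMatrix (j : ℕ) : Matrix (Fin (dim m K d (j + 1))) (Fin (K + 1)) ℝ :=
  Matrix.of fun i => Fin.cases 0 fun t =>
    if h : layerStart m t = j then θ.C t (Fin.cast (by rw [h]) i) else 0

/-- Layer `j + 1` of the network that processes the feature `y` along a walk with vector `z`. -/
def layerMap (z : Fin (K + 1) → ℝ) (j : ℕ) (y : Fin (dim m K d j) → ℝ) :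
    Fin (dim m K d (j + 1)) → ℝ :=
  relu (θ.weightMatrix j *ᵥ y + θ.edgeMatrix j *ᵥ z + θ.biasVector j)

/-- The aggregation network `AGG^{t+1}`, at the feature `y` and the edge weight `w`. -/
def agg (t : Fin K) (w : ℝ) (y : Fin (dim m K d (layerStart m t)) → ℝ) :
    Fin (dim m K d (layerStart m t + m)) → ℝ :=
  fnn θ (layerStart m t) (w • θ.C t) m (layerStart_le t) y

/-- The update network `UPD^{t+1}`. -/
def upd (t : Fin K) (y : Fin (dim m K d (layerStart m t + m)) → ℝ) :
    Fin (dim m K d (layerStart m t + m + m)) → ℝ :=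
  fnn θ (layerStart m t + m) 0 m (layerStart_succ_le t.isLt) y

theorem weightMatrix_of_lt {j : ℕ} (h : j < 2 * m * K) : θ.weightMatrix j = θ.W ⟨j, h⟩ := dif_pos h

theorem biasVector_of_lt {j : ℕ} (h : j < 2 * m * K) : θ.biasVector j = θ.b ⟨j, h⟩ := dif_pos h

theorem edgeMatrix_eq_zero {j : ℕ} (hj : ∀ t, layerStart m t ≠ j) : θ.edgeMatrix j = 0 := by
  ext i k
  cases k using Fin.cases <;> simp [edgeMatrix, hj]

theorem edgeMatrix_layerStart_mulVec (hm : 0 < m) (t : Fin K) (z : Fin (K + 1) → ℝ) :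
    θ.edgeMatrix (layerStart m t) *ᵥ z = z t.succ • θ.C t := by
  ext i
  have h_col (s : Fin K) : layerStart m s = layerStart m t ↔ s = t :=
    (layerStart_injective hm).eq_iff.trans Fin.val_inj
  change ∑ k, θ.edgeMatrix (layerStart m t) i k * z k = z t.succ * θ.C t i
  rw [Fin.sum_univ_succ, Finset.sum_eq_single t] <;>
    simp +contextual [edgeMatrix, h_col, mul_comm]

theorem fnn_induction {z : Fin (K + 1) → ℝ} {P : ∀ j, (Fin (dim m K d j) → ℝ) → Prop}
    (hP : ∀ j y, P j y → P (j + 1) (θ.layerMap z j y)) {s : ℕ} {y : Fin (dim m K d s) → ℝ}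
    (hy : P s y) : ∀ (n : ℕ) (h : s + n ≤ 2 * m * K),
    (∀ i, 0 < i → i < n → θ.edgeMatrix (s + i) = 0) →
    P (s + n) (fnn θ s (θ.edgeMatrix s *ᵥ z) n h y)
  | 0, _, _ => hy
  | 1, h, _ => by
    have h_next := hP s y hy
    rwa [layerMap, θ.weightMatrix_of_lt h, θ.biasVector_of_lt h] at h_next
  | n + 2, h, hE => by
    have ih := fnn_induction hP hy (n + 1) (Nat.le_of_succ_le h) fun i h0 hi => hE i h0 (by omega)
    have h_next := hP _ _ ih
    rwa [layerMap, hE (n + 1) n.succ_pos (by omega), Matrix.zero_mulVec, add_zero,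
      θ.weightMatrix_of_lt (j := s + (n + 1)) h, θ.biasVector_of_lt (j := s + (n + 1)) h] at h_next

theorem agg_induction (hm : 0 < m) {z : Fin (K + 1) → ℝ}
    {P : ∀ j, (Fin (dim m K d j) → ℝ) → Prop} (hP : ∀ j y, P j y → P (j + 1) (θ.layerMap z j y))
    (t : Fin K) {y : Fin (dim m K d (layerStart m t)) → ℝ} (hy : P (layerStart m t) y) :
    P (layerStart m t + m) (θ.agg t (z t.succ) y) := by
  rw [agg, ← θ.edgeMatrix_layerStart_mulVec hm]
  exact θ.fnn_induction hP hy m _ fun i h0 hi => θ.edgeMatrix_eq_zero fun s =>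
    (layerStart_add_ne_layerStart t s h0 (by omega)).symm

theorem upd_induction (hm : 0 < m) {z : Fin (K + 1) → ℝ}
    {P : ∀ j, (Fin (dim m K d j) → ℝ) → Prop} (hP : ∀ j y, P j y → P (j + 1) (θ.layerMap z j y))
    (t : Fin K) {y : Fin (dim m K d (layerStart m t + m)) → ℝ} (hy : P (layerStart m t + m) y) :
    P (layerStart m t + m + m) (θ.upd t y) := by
  have h_edge (i : ℕ) (hi : i < m) : θ.edgeMatrix (layerStart m t + m + i) = 0 :=
    θ.edgeMatrix_eq_zero fun s => by
      rw [add_assoc]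
      exact (layerStart_add_ne_layerStart t s (by omega) (by omega)).symm
  have h_upd := θ.fnn_induction hP hy m (layerStart_succ_le t.isLt) fun i _ hi => h_edge i hi
  rwa [show θ.edgeMatrix (layerStart m t + m) = 0 from h_edge 0 hm, Matrix.zero_mulVec] at h_upd

theorem fnn_nonneg (s : ℕ) (e : Fin (dim m K d (s + 1)) → ℝ) :
    ∀ (n : ℕ) (h : s + n ≤ 2 * m * K) (y : Fin (dim m K d s) → ℝ) (i : Fin (dim m K d (s + n))),
    0 < n → 0 ≤ fnn θ s e n h y i
  | 1, _, _, _, _ => relu_nonneg _ _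
  | _ + 2, _, _, _, _ => relu_nonneg _ _

theorem agg_nonneg (hm : 0 < m) (t : Fin K) (w : ℝ) (y : Fin (dim m K d (layerStart m t)) → ℝ)
    (i : Fin (dim m K d (layerStart m t + m))) : 0 ≤ θ.agg t w y i :=
  θ.fnn_nonneg _ _ _ _ _ _ hm

/-! ### Bounds for a single layer -/

/-- The matrix that maps the vector of a walk to the main term of the feature after layer `j`:
the product of the entrywise positive parts of the weight matrices. -/
def upperMatrix : (j : ℕ) → Matrix (Fin (dim m K d j)) (Fin (K + 1)) ℝ
  | 0 => Matrix.of fun _ => Pi.single 0 1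
  | j + 1 => (θ.weightMatrix j).map (·⁺) * upperMatrix j + (θ.edgeMatrix j).map (·⁺)

/-- An upper bound for the `k`-th column of `upperMatrix j`: the product of the norms of the
matrices through which the `k`-th entry of the vector of a walk passes. -/
def gainBound : ℕ → Fin (K + 1) → ℝ
  | 0 => Pi.single 0 1
  | j + 1 => fun k => matNorm (θ.weightMatrix j) * gainBound j k + vecNorm ((θ.edgeMatrix j).col k)

/-- A bound for the contribution of the bias vectors to the features after layer `j`. -/
def biasBound : ℕ → ℝ
  | 0 => 0
  | j + 1 => matNorm (θ.weightMatrix j) * biasBound j + vecNorm (θ.biasVector j)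

/-- The feature `y` after layer `j` is nonnegative and at most its main term along a walk with
vector `z`, up to the contribution of the bias vectors. -/
def UpperBounded (z : Fin (K + 1) → ℝ) (j : ℕ) (y : Fin (dim m K d j) → ℝ) : Prop :=
  ∀ i, 0 ≤ y i ∧ y i ≤ (θ.upperMatrix j *ᵥ z) i + θ.biasBound j

/-- The feature `y` after layer `j` falls short of its main term along a walk with vector `z` by at
most the gap between `gainBound` and `upperMatrix`, up to the contribution of the bias vectors. -/
def LowerBounded (z : Fin (K + 1) → ℝ) (j : ℕ) (y : Fin (dim m K d j) → ℝ) : Prop :=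
  ∀ i, 2 * (θ.upperMatrix j *ᵥ z) i - θ.gainBound j ⬝ᵥ z - θ.biasBound j ≤ y i

theorem biasBound_nonneg (j : ℕ) : 0 ≤ θ.biasBound j := by
  induction j with
  | zero => exact le_rfl
  | succ j ih => exact add_nonneg (mul_nonneg (matNorm_nonneg _) ih) (vecNorm_nonneg _)

theorem gainBound_nonneg (j : ℕ) (k : Fin (K + 1)) : 0 ≤ θ.gainBound j k := by
  induction j with
  | zero => exact Pi.single_nonneg (α := fun _ : Fin (K + 1) => ℝ) |>.2 zero_le_one k
  | succ j ih => exact add_nonneg (mul_nonneg (matNorm_nonneg _) ih) (vecNorm_nonneg _)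

theorem upperMatrix_nonneg (j : ℕ) (i : Fin (dim m K d j)) (k : Fin (K + 1)) :
    0 ≤ θ.upperMatrix j i k := by
  induction j with
  | zero => exact θ.gainBound_nonneg 0 k
  | succ j ih =>
    have h_weight : 0 ≤ ((θ.weightMatrix j).map (·⁺) *ᵥ fun c => θ.upperMatrix j c k) i :=
      dotProduct_nonneg_of_nonneg (fun _ => posPart_nonneg _) ih
    exact add_nonneg h_weight (posPart_nonneg _)

theorem upperMatrix_le_gainBound (j : ℕ) (i : Fin (dim m K d j)) (k : Fin (K + 1)) :
    θ.upperMatrix j i k ≤ θ.gainBound j k := by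
  induction j with
  | zero => exact le_rfl
  | succ j ih =>
    exact add_le_add
      (posPart_mulVec_le _ (θ.gainBound_nonneg j k) (fun c => θ.upperMatrix_nonneg j c k) ih i)
      ((posPart_le_abs _).trans (abs_le_vecNorm ((θ.edgeMatrix j).col k) i))

variable {z : Fin (K + 1) → ℝ}

theorem UpperBounded.layerMap (hz : 0 ≤ z) (j : ℕ) (y : Fin (dim m K d j) → ℝ)
    (hy : θ.UpperBounded z j y) : θ.UpperBounded z (j + 1) (θ.layerMap z j y) := by
  intro r
  have h_weight := mulVec_le_posPart_mulVec_add (θ.weightMatrix j) (θ.biasBound_nonneg j)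
    (fun i => (hy i).1) (fun i => (hy i).2) r
  have h_edge := mulVec_le_posPart_mulVec_add (θ.edgeMatrix j) le_rfl hz
    (fun k => (add_zero (z k)).ge) r
  have h_bias := (le_abs_self _).trans (abs_le_vecNorm (θ.biasVector j) r)
  refine ⟨relu_nonneg _ _, max_le ?_ ?_⟩
  · exact add_nonneg (dotProduct_nonneg_of_nonneg (θ.upperMatrix_nonneg _ r) hz)
      (θ.biasBound_nonneg _)
  · simp only [upperMatrix, biasBound, Matrix.add_mulVec, ← Matrix.mulVec_mulVec, Pi.add_apply]
    linarith

theorem LowerBounded.layerMap (hz : 0 ≤ z) (j : ℕ) (y : Fin (dim m K d j) → ℝ)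
    (hy : θ.UpperBounded z j y) (hy' : θ.LowerBounded z j y) :
    θ.LowerBounded z (j + 1) (θ.layerMap z j y) := by
  intro r
  have h_gain : 0 ≤ θ.gainBound j ⬝ᵥ z := dotProduct_nonneg_of_nonneg (θ.gainBound_nonneg j) hz
  have h_weight := posPart_mulVec_sub_le_mulVec (θ.weightMatrix j) (u := θ.upperMatrix j *ᵥ z)
    (add_nonneg h_gain (θ.biasBound_nonneg j))
    (fun i => dotProduct_le_dotProduct_of_nonneg_right (θ.upperMatrix_le_gainBound j i) hz)
    (fun i => (hy i).2) hy' r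
  have h_edge := posPart_mulVec_sub_colNorm_le_mulVec (θ.edgeMatrix j) hz r
  have h_bias := neg_le_of_abs_le (abs_le_vecNorm (θ.biasVector j) r)
  have h_split : θ.gainBound (j + 1) ⬝ᵥ z = matNorm (θ.weightMatrix j) * θ.gainBound j ⬝ᵥ z
      + (fun k => vecNorm ((θ.edgeMatrix j).col k)) ⬝ᵥ z := by
    rw [← smul_eq_mul, ← smul_dotProduct, ← add_dotProduct]
    rfl
  refine le_max_of_le_right ?_
  rw [h_split]
  simp only [upperMatrix, biasBound, Matrix.add_mulVec, ← Matrix.mulVec_mulVec, Pi.add_apply]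
  linarith

end Params

/-! ### Walks and Bellman-Ford distances -/

theorem exists_backward_chain {α : Type*} {K : ℕ} (R : Fin K → α → α → Prop)
    (hR : ∀ t b, ∃ a, R t a b) (v : α) :
    ∃ u : Fin (K + 1) → α, u (Fin.last K) = v ∧ ∀ t, R t (u t.castSucc) (u t.succ) := by
  induction K generalizing v with
  | zero => exact ⟨fun _ => v, rfl, fun t => t.elim0⟩
  | succ K ih =>
    obtain ⟨w, hw⟩ := hR (Fin.last K) v
    obtain ⟨u, rfl, hu⟩ := ih (fun t => R t.castSucc) (fun t => hR t.castSucc) w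
    refine ⟨Fin.snoc (α := fun _ => α) u v, Fin.snoc_last _ _, fun t => ?_⟩
    cases t using Fin.lastCases with
    | last => simpa only [Fin.snoc_castSucc, Fin.succ_last, Fin.snoc_last] using hw
    | cast t => simpa only [Fin.snoc_castSucc, Fin.succ_castSucc] using hu t

theorem last_eq_zero_add_sum_sub {K : ℕ} (f : Fin (K + 1) → ℝ) :
    f (Fin.last K) = f 0 + ∑ t : Fin K, (f t.succ - f t.castSucc) := by
  induction K with
  | zero => simp
  | succ K ih =>
    rw [Fin.sum_univ_castSucc, ← add_assoc]
    have h_init := ih (Fin.init f)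
    simp only [Fin.init, Fin.castSucc_zero, ← Fin.succ_castSucc] at h_init ⊢
    rw [← h_init]
    simp

namespace BFInstance

theorem mem_nbrs (G : BFInstance.{u}) {v w : G.V} : w ∈ G.nbrs v ↔ w = v ∨ G.graph.Adj v w := by
  simp [nbrs]

theorem weight_comm (G : BFInstance.{u}) (v w : G.V) : G.weight v w = G.weight w v := by
  unfold weight
  by_cases h : G.graph.Adj v w
  · rw [dif_pos h, dif_pos h.symm]
    congr 2
    exact Sym2.eq_swap
  · rw [dif_neg h, dif_neg fun h' => h h'.symm]

theorem dist_succ (t : ℕ) (G : BFInstance.{u}) (v : G.V) :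
    dist (t + 1) G v
      = (G.nbrs v).inf' (G.nbrs_nonempty v) fun u => dist t G u + G.weight u v := by
  induction t generalizing G with
  | zero => rfl
  | succ _ ih => exact ih G.update v

theorem dist_succ_le (t : ℕ) (G : BFInstance.{u}) {u v : G.V} (hu : u ∈ G.nbrs v) :
    dist (t + 1) G v ≤ dist t G u + G.weight v u := by
  rw [dist_succ, weight_comm]
  exact Finset.inf'_le (fun u => dist t G u + G.weight u v) hu

theorem exists_dist_succ_eq (t : ℕ) (G : BFInstance.{u}) (v : G.V) :
    ∃ u ∈ G.nbrs v, dist (t + 1) G v = dist t G u + G.weight v u := by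
  simp only [dist_succ, G.weight_comm v]
  exact Finset.exists_mem_eq_inf' _ _

theorem le_dist_of_potential (G : BFInstance.{u}) {φ : G.V → ℝ≥0} (h_label : ∀ v, φ v ≤ G.label v)
    (h_weight : ∀ v, ∀ u ∈ G.nbrs v, φ v ≤ φ u + G.weight v u) (t : ℕ) (v : G.V) :
    φ v ≤ dist t G v := by
  induction t generalizing v with
  | zero => exact h_label v
  | succ t ih =>
    obtain ⟨u, hu, h_eq⟩ := exists_dist_succ_eq t G v
    rw [h_eq]
    exact (h_weight v u hu).trans (add_le_add_left (ih u) _)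

/-- A walk with `K` steps, each of which stays where it is or follows an edge. -/
def IsWalk (G : BFInstance.{u}) (u : Fin (K + 1) → G.V) : Prop :=
  ∀ t : Fin K, u t.castSucc ∈ G.nbrs (u t.succ)

/-- The vector of a walk: the label of its first vertex, followed by the weights of its steps. -/
noncomputable def walkCost (G : BFInstance.{u}) (u : Fin (K + 1) → G.V) : Fin (K + 1) → ℝ :=
  Fin.cons (G.label (u 0) : ℝ) fun t => (G.weight (u t.succ) (u t.castSucc) : ℝ)

theorem walkCost_nonneg (G : BFInstance.{u}) (u : Fin (K + 1) → G.V) : 0 ≤ G.walkCost u := by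
  intro k
  cases k using Fin.cases <;> simp [walkCost]

theorem dist_le_sum_walkCost (G : BFInstance.{u}) {u : Fin (K + 1) → G.V} (hu : G.IsWalk u) :
    (G.dist K (u (Fin.last K)) : ℝ) ≤ ∑ k, G.walkCost u k := by
  have h_sum := last_eq_zero_add_sum_sub fun t : Fin (K + 1) => (G.dist t (u t) : ℝ)
  simp only [Fin.val_last] at h_sum
  rw [h_sum, Fin.sum_univ_succ]
  refine add_le_add le_rfl (Finset.sum_le_sum fun t _ => sub_le_iff_le_add'.2 ?_)
  exact_mod_cast dist_succ_le t G (hu t)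

theorem exists_sum_walkCost_le_dist (G : BFInstance.{u}) (K : ℕ) (v : G.V) :
    ∃ u : Fin (K + 1) → G.V, u (Fin.last K) = v ∧ G.IsWalk u ∧
      ∑ k, G.walkCost u k ≤ G.dist K v := by
  obtain ⟨u, rfl, hu⟩ := exists_backward_chain (fun (t : Fin K) a b => a ∈ G.nbrs b ∧
    dist (t + 1) G b = dist t G a + G.weight b a) (fun t b => exists_dist_succ_eq t G b) v
  refine ⟨u, rfl, fun t => (hu t).1, ?_⟩
  have h_sum := last_eq_zero_add_sum_sub fun t : Fin (K + 1) => (G.dist t (u t) : ℝ)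
  simp only [Fin.val_last] at h_sum
  rw [h_sum, Fin.sum_univ_succ]
  refine add_le_add le_rfl (Finset.sum_le_sum fun t _ => le_sub_iff_add_le'.2 ?_)
  exact_mod_cast (hu t).2.ge

end BFInstance

/-! ### The path training set -/

theorem weight_pathInstance (β : ℝ≥0) (z : Fin (K + 1) → ℝ≥0) (t : Fin K) :
    (pathInstance K β z).weight t.succ t.castSucc = z t.succ := by
  have h_adj : (SimpleGraph.pathGraph (K + 1)).Adj t.succ t.castSucc :=
    SimpleGraph.pathGraph_adj.2 (Or.inr rfl)
  have h_sup : (s(t.succ, t.castSucc) : Sym2 (Fin (K + 1))).sup = t.succ :=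
    sup_eq_left.2 t.castSucc_lt_succ.le
  exact (dif_pos h_adj).trans (congrArg z h_sup)

theorem isWalk_pathInstance (β : ℝ≥0) (z : Fin (K + 1) → ℝ≥0) :
    (pathInstance K β z).IsWalk (id : Fin (K + 1) → Fin (K + 1)) := fun _ =>
  (BFInstance.mem_nbrs _).2 (Or.inr (SimpleGraph.pathGraph_adj.2 (Or.inr rfl)))

theorem walkCost_pathInstance (β : ℝ≥0) (z : Fin (K + 1) → ℝ≥0) :
    (pathInstance K β z).walkCost (id : Fin (K + 1) → Fin (K + 1)) = fun k => (z k : ℝ) := by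
  funext k
  cases k using Fin.cases with
  | zero => rfl
  | succ t => exact congrArg NNReal.toReal (weight_pathInstance β z t)

theorem eq_castSucc_of_mem_nbrs_pathInstance {β : ℝ≥0} {z : Fin (K + 1) → ℝ≥0}
    {i j : Fin (K + 1)} (hj : j ∈ (pathInstance K β z).nbrs i) (hji : j < i) :
    ∃ t : Fin K, i = t.succ ∧ j = t.castSucc := by
  have h_adj : (SimpleGraph.pathGraph (K + 1)).Adj i j :=
    ((BFInstance.mem_nbrs _).1 hj).resolve_left hji.ne
  have h_val : j.val + 1 = i.val :=
    (SimpleGraph.pathGraph_adj.1 h_adj).resolve_left fun h => by omega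
  exact ⟨⟨j, by omega⟩, Fin.ext h_val.symm, rfl⟩

theorem le_dist_pathInstance_single {β x : ℝ≥0} (hβ : x ≤ β) (k : Fin (K + 1)) (t : ℕ) :
    x ≤ (pathInstance K β (Pi.single k x)).dist t (Fin.last K) := by
  let φ (i : Fin (K + 1)) : ℝ≥0 := if k ≤ i then x else 0
  have h_label (i : Fin (K + 1)) : φ i ≤ (pathInstance K β (Pi.single k x)).label i := by
    change φ i ≤ if i = 0 then Pi.single (M := fun _ => ℝ≥0) k x 0 else β
    obtain rfl | hi := eq_or_ne i 0
    · simp [φ, Pi.single_apply, eq_comm]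
    · rw [if_neg hi]
      exact (ite_le_sup _ _ _).trans (by simpa using hβ)
  have h_weight (i j : Fin (K + 1)) (hj : j ∈ (pathInstance K β (Pi.single k x)).nbrs i) :
      φ i ≤ φ j + (pathInstance K β (Pi.single k x)).weight i j := by
    by_cases hkj : k ≤ j
    · simp only [φ, hkj, if_true]
      exact le_add_right (by split_ifs <;> simp)
    by_cases hki : k ≤ i
    · obtain ⟨t, rfl, rfl⟩ :=
        eq_castSucc_of_mem_nbrs_pathInstance hj ((not_le.1 hkj).trans_le hki)
      obtain rfl : k = t.succ := le_antisymm hki (Fin.castSucc_lt_iff_succ_le.1 (not_le.1 hkj))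
      rw [weight_pathInstance, Pi.single_eq_same]
      exact le_add_left (by simp [φ])
    · simp [φ, hki]
  have h_dist := BFInstance.le_dist_of_potential (pathInstance K β (Pi.single k x)) (φ := φ)
    h_label h_weight t (Fin.last K)
  exact (if_pos (Fin.le_last k)).ge.trans h_dist

theorem pathInstance_injective (β : ℝ≥0) : Function.Injective (pathInstance K β) := by
  intro z z' h
  have h_cost (G : BFInstance.{0}) (hG : pathInstance K β z = G) (u : Fin (K + 1) → G.V)
      (hu : HEq u (id : Fin (K + 1) → Fin (K + 1))) (k : Fin (K + 1)) : z k = G.walkCost u k := by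
    subst hG
    rw [eq_of_heq hu, walkCost_pathInstance]
  funext k
  exact NNReal.coe_injective ((h_cost _ h id HEq.rfl k).trans
    (congrFun (walkCost_pathInstance β z') k))

theorem pathTrainingPair_injective (β : ℝ≥0) {x : ℝ≥0} (hx : x ≠ 0) :
    Function.Injective fun k : Fin (K + 1) =>
      (⟨pathInstance K β (Pi.single k x), Fin.last K⟩ : VertexInstance.{0}) := fun k k' h => by
  have h_single := congrFun (pathInstance_injective β (congrArg Sigma.fst h)) k
  by_contra h_ne
  rw [Pi.single_eq_same, Pi.single_eq_of_ne h_ne] at h_single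
  exact hx h_single

namespace Params

variable (θ : Params m K d)

/-! ### Features along walks -/

theorem feature_succ (G : BFInstance.{u}) (t : Fin K) (v : G.V) :
    feature θ G (t + 1) t.isLt v = θ.upd t fun i =>
      (G.nbrs v).inf' (G.nbrs_nonempty v) fun w =>
        θ.agg t (G.weight v w) (feature θ G t t.isLt.le w) i :=
  rfl

theorem exists_feature_succ_eq (G : BFInstance.{u}) (t : Fin K) (v : G.V) :
    ∃ w ∈ G.nbrs v, feature θ G (t + 1) t.isLt v
      = θ.upd t (θ.agg t (G.weight v w) (feature θ G t t.isLt.le w)) := by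
  have := subsingleton_dim_aggregated (m := m) (d := d) t
  let i₀ : Fin (dim m K d (layerStart m t + m)) := ⟨0, by rw [dim_aggregated]; exact Nat.one_pos⟩
  obtain ⟨w, hw, h_min⟩ := Finset.exists_mem_eq_inf' (G.nbrs_nonempty v) fun w =>
    θ.agg t (G.weight v w) (feature θ G t t.isLt.le w) i₀
  refine ⟨w, hw, ?_⟩
  rw [feature_succ]
  congr 1
  funext i
  rwa [Subsingleton.elim i i₀]

theorem upperBounded_feature (hm : 0 < m) (G : BFInstance.{u}) {u : Fin (K + 1) → G.V}
    (hu : G.IsWalk u) (t : Fin (K + 1)) :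
    θ.UpperBounded (G.walkCost u) (layerStart m t) (feature θ G t t.is_le (u t)) := by
  have h_layer := UpperBounded.layerMap θ (G.walkCost_nonneg u)
  induction t using Fin.induction with
  | zero =>
    intro i
    have h_label : (θ.upperMatrix 0 *ᵥ G.walkCost u) i = G.label (u 0) :=
      single_one_dotProduct 0 (G.walkCost u)
    change 0 ≤ (G.label (u 0) : ℝ) ∧ (G.label (u 0) : ℝ) ≤ (θ.upperMatrix 0 *ᵥ G.walkCost u) i + 0
    rw [h_label, add_zero]
    exact ⟨NNReal.coe_nonneg _, le_rfl⟩
  | succ t ih =>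
    have h_agg := θ.agg_induction hm h_layer t ih
    refine θ.upd_induction hm h_layer t fun i => ⟨?_, ?_⟩
    · exact Finset.le_inf' _ _ fun w _ => θ.agg_nonneg hm t _ _ i
    · exact (Finset.inf'_le _ (hu t)).trans (h_agg i).2

theorem exists_lowerBounded_feature (hm : 0 < m) (G : BFInstance.{u}) (v : G.V) :
    ∃ u : Fin (K + 1) → G.V, u (Fin.last K) = v ∧ G.IsWalk u ∧
      θ.LowerBounded (G.walkCost u) (layerStart m K) (feature θ G K le_rfl v) := by
  obtain ⟨u, rfl, hu⟩ := exists_backward_chain (fun (t : Fin K) a b => a ∈ G.nbrs b ∧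
    feature θ G (t + 1) t.isLt b = θ.upd t (θ.agg t (G.weight b a) (feature θ G t t.isLt.le a)))
    (fun t b => θ.exists_feature_succ_eq G t b) v
  let P (j : ℕ) (y : Fin (dim m K d j) → ℝ) : Prop :=
    θ.UpperBounded (G.walkCost u) j y ∧ θ.LowerBounded (G.walkCost u) j y
  have h_layer (j : ℕ) (y : Fin (dim m K d j) → ℝ) (hy : P j y) :
      P (j + 1) (θ.layerMap (G.walkCost u) j y) :=
    ⟨hy.1.layerMap θ (G.walkCost_nonneg u), hy.2.layerMap θ (G.walkCost_nonneg u) j y hy.1⟩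
  have h_walk : G.IsWalk u := fun t => (hu t).1
  suffices h : ∀ t : Fin (K + 1), P (layerStart m t) (feature θ G t t.is_le (u t)) from
    ⟨u, rfl, h_walk, (h (Fin.last K)).2⟩
  intro t
  induction t using Fin.induction with
  | zero =>
    refine ⟨θ.upperBounded_feature hm G h_walk 0, fun i => ?_⟩
    have h_label : (θ.upperMatrix 0 *ᵥ G.walkCost u) i = G.label (u 0) :=
      single_one_dotProduct 0 (G.walkCost u)
    have h_gain : θ.gainBound 0 ⬝ᵥ G.walkCost u = G.label (u 0) :=
      single_one_dotProduct 0 (G.walkCost u)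
    change 2 * (θ.upperMatrix 0 *ᵥ G.walkCost u) i - θ.gainBound 0 ⬝ᵥ G.walkCost u - 0
      ≤ (G.label (u 0) : ℝ)
    rw [h_label, h_gain]
    linarith
  | succ t ih =>
    change P (layerStart m t + m + m) (feature θ G (t + 1) _ (u t.succ))
    rw [(hu t).2]
    exact θ.upd_induction hm h_layer t (θ.agg_induction hm h_layer t ih)

/-- The coefficient of the `k`-th entry of the vector of a walk in the main term of the output. -/
def pathCoeff (k : Fin (K + 1)) : ℝ :=
  θ.upperMatrix (layerStart m K) ⟨0, by rw [dim_layerStart_last]; exact Nat.one_pos⟩ k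

/-- The product of the norms of the matrices through which the `k`-th entry of the vector of a walk
passes on its way to the output. -/
def pathGain (k : Fin (K + 1)) : ℝ := θ.gainBound (layerStart m K) k

/-- A bound for the contribution of the bias vectors to the output. -/
def outputBias : ℝ := θ.biasBound (layerStart m K)

theorem pathCoeff_le_pathGain (k : Fin (K + 1)) : θ.pathCoeff k ≤ θ.pathGain k :=
  θ.upperMatrix_le_gainBound _ _ k

theorem output_le (hm : 0 < m) (G : BFInstance.{u}) {u : Fin (K + 1) → G.V} (hu : G.IsWalk u) :
    output θ G (u (Fin.last K)) ≤ θ.pathCoeff ⬝ᵥ G.walkCost u + θ.outputBias :=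
  (θ.upperBounded_feature hm G hu (Fin.last K) _).2

theorem exists_le_output (hm : 0 < m) (G : BFInstance.{u}) (v : G.V) :
    ∃ u : Fin (K + 1) → G.V, u (Fin.last K) = v ∧ G.IsWalk u ∧
      2 * θ.pathCoeff ⬝ᵥ G.walkCost u - θ.pathGain ⬝ᵥ G.walkCost u - θ.outputBias
        ≤ output θ G v := by
  obtain ⟨u, rfl, hu, h_lower⟩ := θ.exists_lowerBounded_feature hm G v
  exact ⟨u, rfl, hu, h_lower _⟩

end Params

/-! ### The regularizer -/

/-- The layers, counted from `0`, that an edge weight of step `k` passes through; for `k = 0` these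
are the layers that the label of a vertex passes through, i.e. all of them. -/
def activeLayers (m K k : ℕ) : Finset ℕ := Finset.Ico (edgeLayer m k - 1) (2 * m * K)

theorem edgeLayer_le (hm : 0 < m) (k : Fin (K + 1)) : edgeLayer m k ≤ 2 * m * K := by
  cases k using Fin.cases with
  | zero => exact Nat.zero_le _
  | succ t => exact layerStart_lt hm t

theorem card_activeLayers_le (m K k : ℕ) : (activeLayers m K k).card ≤ 2 * m * K := by
  rw [activeLayers, Nat.card_Ico]
  exact Nat.sub_le _ _

theorem sum_card_activeLayers (m K : ℕ) :
    ∑ k : Fin (K + 1), ((activeLayers m K k).card : ℝ) = m * (K ^ 2 + 3 * K) := by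
  have h_step (t : Fin K) : ((activeLayers m K t.succ).card : ℝ) = 2 * m * (K - t) := by
    have h_le := Nat.mul_le_mul_left (2 * m) t.isLt.le
    rw [Fin.val_succ, activeLayers, Nat.card_Ico, edgeLayer, Nat.add_sub_cancel, layerStart_eq,
      Nat.cast_sub h_le]
    push_cast
    ring
  have h_gauss : ∑ t ∈ Finset.range K, (t : ℝ) = K * (K - 1) / 2 := by
    rw [← Nat.cast_sum, Finset.sum_range_id, ← Nat.choose_two_right, Nat.cast_choose_two]
  rw [Fin.sum_univ_succ, Finset.sum_congr rfl fun t _ => h_step t, ← Finset.mul_sum,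
    Finset.sum_sub_distrib, Fin.sum_univ_eq_sum_range fun t => (t : ℝ), h_gauss]
  simp only [activeLayers, edgeLayer, Fin.val_zero, Nat.card_Ico, Finset.sum_const,
    Finset.card_univ, Fintype.card_fin, nsmul_eq_mul, Nat.zero_sub, Nat.sub_zero]
  push_cast
  ring

namespace Params

variable (θ : Params m K d)

/-- The norm of the matrix or vector of layer `j + 1` that acts on a signal which entered the
network at the first aggregation layer of step `k` as an edge weight, or as a label if `k = 0`. -/
def layerNorm (k : Fin (K + 1)) (j : ℕ) : ℝ :=
  if edgeLayer m k = j + 1 then vecNorm ((θ.edgeMatrix j).col k) else matNorm (θ.weightMatrix j)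

/-- The sum of the norms of the matrices through which the `k`-th entry of the vector of a walk
passes on its way to the output. -/
def pathNorm (k : Fin (K + 1)) : ℝ := ∑ j ∈ activeLayers m K k, θ.layerNorm k j

/-- The sum of the norms of the bias vectors. -/
def biasNorm : ℝ := ∑ j ∈ Finset.range (2 * m * K), vecNorm (θ.biasVector j)

theorem layerNorm_nonneg (k : Fin (K + 1)) (j : ℕ) : 0 ≤ θ.layerNorm k j := by
  unfold layerNorm
  split_ifs
  exacts [vecNorm_nonneg _, matNorm_nonneg _]

theorem pathNorm_nonneg (k : Fin (K + 1)) : 0 ≤ θ.pathNorm k :=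
  Finset.sum_nonneg fun j _ => θ.layerNorm_nonneg k j

theorem biasNorm_nonneg : 0 ≤ θ.biasNorm := Finset.sum_nonneg fun _ _ => vecNorm_nonneg _

theorem vecNorm_edgeMatrix_col_eq_zero {j : ℕ} {k : Fin (K + 1)} (h : edgeLayer m k ≠ j + 1) :
    vecNorm ((θ.edgeMatrix j).col k) = 0 := by
  refine Finset.sum_eq_zero fun i _ => abs_eq_zero.2 ?_
  cases k using Fin.cases with
  | zero => rfl
  | succ t => exact dif_neg fun ht => h (congrArg (· + 1) ht)

theorem gainBound_succ (j : ℕ) (k : Fin (K + 1)) : θ.gainBound (j + 1) k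
    = matNorm (θ.weightMatrix j) * θ.gainBound j k + vecNorm ((θ.edgeMatrix j).col k) :=
  rfl

theorem edgeMatrix_layerStart_col (t : Fin K) :
    (θ.edgeMatrix (layerStart m t)).col t.succ = θ.C t :=
  funext fun _ => dif_pos rfl

theorem gainBound_eq_zero {j : ℕ} {k : Fin (K + 1)} (h : j < edgeLayer m k) :
    θ.gainBound j k = 0 := by
  induction j with
  | zero =>
    refine Pi.single_eq_of_ne (M := fun _ => ℝ) ?_ 1
    rintro rfl
    exact h.false
  | succ j ih =>
    rw [gainBound_succ, ih (Nat.lt_of_succ_lt h), θ.vecNorm_edgeMatrix_col_eq_zero h.ne', mul_zero,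
      add_zero]

theorem gainBound_eq_prod_layerNorm {j : ℕ} {k : Fin (K + 1)} (h : edgeLayer m k ≤ j) :
    θ.gainBound j k = ∏ i ∈ Finset.Ico (edgeLayer m k - 1) j, θ.layerNorm k i := by
  induction j with
  | zero =>
    obtain rfl : k = 0 := by
      cases k using Fin.cases with
      | zero => rfl
      | succ t => exact absurd h (Nat.not_succ_le_zero _)
    exact Pi.single_eq_same (M := fun _ => ℝ) 0 1
  | succ j ih =>
    obtain h_eq | h_lt := h.eq_or_lt
    · have h_zero := θ.gainBound_eq_zero (j.lt_succ_self.trans_eq h_eq.symm)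
      rw [gainBound_succ, h_zero, mul_zero, zero_add, h_eq, Nat.add_sub_cancel,
        Nat.Ico_succ_singleton, Finset.prod_singleton, layerNorm, if_pos h_eq]
    · have h_norm : θ.layerNorm k j = matNorm (θ.weightMatrix j) := if_neg h_lt.ne
      rw [Finset.prod_Ico_succ_top (by omega), ← ih (Nat.lt_succ_iff.1 h_lt), h_norm,
        gainBound_succ, θ.vecNorm_edgeMatrix_col_eq_zero h_lt.ne, add_zero, mul_comm]

theorem pathGain_eq_prod_layerNorm (hm : 0 < m) (k : Fin (K + 1)) :
    θ.pathGain k = ∏ j ∈ activeLayers m K k, θ.layerNorm k j := by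
  rw [pathGain, layerStart_eq, gainBound_eq_prod_layerNorm θ (edgeLayer_le hm k), activeLayers]

theorem pathGain_le_exp (hm : 0 < m) (k : Fin (K + 1)) :
    θ.pathGain k ≤ Real.exp (θ.pathNorm k - (activeLayers m K k).card) := by
  rw [θ.pathGain_eq_prod_layerNorm hm]
  exact prod_le_exp_sum_sub_card _ fun j _ => θ.layerNorm_nonneg k j

theorem card_activeLayers_sub_pathNorm_le (hm : 0 < m) (hK : 0 < K) (k : Fin (K + 1)) :
    (activeLayers m K k).card - θ.pathNorm k ≤ 3 * (m * K) * max 0 (1 - θ.pathCoeff k) := by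
  have h_coeff := (θ.pathCoeff_le_pathGain k).trans_eq (θ.pathGain_eq_prod_layerNorm hm k)
  refine (card_sub_sum_le_of_le_prod _ (fun j _ => θ.layerNorm_nonneg k j) h_coeff).trans ?_
  have h_card : (activeLayers m K k).card + 1 ≤ 3 * (m * K) := by
    linarith [card_activeLayers_le m K k, Nat.mul_pos hm hK]
  exact mul_le_mul_of_nonneg_right (by exact_mod_cast h_card) (le_max_left _ _)

theorem pathNorm_zero :
    θ.pathNorm 0 = ∑ j ∈ Finset.range (2 * m * K), matNorm (θ.weightMatrix j) := by
  rw [Finset.range_eq_Ico]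
  rfl

theorem pathNorm_succ (hm : 0 < m) (t : Fin K) : θ.pathNorm t.succ
    = vecNorm (θ.C t) + ∑ j ∈ Finset.Ico (layerStart m t + 1) (2 * m * K),
      matNorm (θ.weightMatrix j) := by
  have h_first : θ.layerNorm t.succ (layerStart m t) = vecNorm (θ.C t) := by
    rw [layerNorm, if_pos (by rfl), edgeMatrix_layerStart_col]
  rw [pathNorm, activeLayers, show edgeLayer m t.succ - 1 = layerStart m t from rfl,
    Finset.sum_eq_sum_Ico_succ_bot (layerStart_lt hm t), h_first]
  refine congrArg _ (Finset.sum_congr rfl fun j hj => if_neg fun h => ?_)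
  have h_eq : layerStart m t + 1 = j + 1 := h
  have := (Finset.mem_Ico.1 hj).1
  omega

theorem sum_matNorm_filter (n : ℕ) :
    ∑ j : Fin (2 * m * K) with n < j.val + 1, ∑ r, ∑ c, |θ.W j r c|
      = ∑ j ∈ Finset.Ico n (2 * m * K), matNorm (θ.weightMatrix j) := by
  have h_weight (j : Fin (2 * m * K)) : ∑ r, ∑ c, |θ.W j r c| = matNorm (θ.weightMatrix j) := by
    rw [θ.weightMatrix_of_lt j.isLt, matNorm]
  simp only [h_weight, Nat.lt_succ_iff, Finset.sum_filter]
  rw [Fin.sum_univ_eq_sum_range (fun j => if n ≤ j then matNorm (θ.weightMatrix j) else 0),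
    ← Finset.sum_filter]
  congr 1
  ext j
  simp [and_comm]

theorem regLoss_eq (hm : 0 < m) : regLoss θ = ∑ k, θ.pathNorm k + θ.biasNorm := by
  have h_bias : ∑ j, ∑ r, |θ.b j r| = θ.biasNorm := by
    rw [biasNorm, ← Fin.sum_univ_eq_sum_range fun j => vecNorm (θ.biasVector j)]
    refine Finset.sum_congr rfl fun j _ => ?_
    rw [θ.biasVector_of_lt j.isLt, vecNorm]
  simp only [regLoss, h_bias, sum_matNorm_filter, Fin.sum_univ_succ, pathNorm_zero,
    θ.pathNorm_succ hm, Finset.sum_add_distrib, Finset.sum_range_succ', vecNorm,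
    Finset.sum_range (n := K)]
  simp only [edgeLayer, Finset.range_eq_Ico]
  ring

theorem biasBound_le (j : ℕ) :
    θ.biasBound j ≤ Real.exp ((∑ i ∈ Finset.range j, matNorm (θ.weightMatrix i)) / 2)
      * ∑ i ∈ Finset.range j, vecNorm (θ.biasVector i) := by
  induction j with
  | zero => simp [biasBound]
  | succ j ih =>
    rw [Finset.sum_range_succ, Finset.sum_range_succ, biasBound, mul_add]
    set s := ∑ i ∈ Finset.range j, matNorm (θ.weightMatrix i)
    set w := matNorm (θ.weightMatrix j)
    have hs : 0 ≤ s := Finset.sum_nonneg fun _ _ => matNorm_nonneg _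
    have hw : 0 ≤ w := matNorm_nonneg _
    have h_exp : w * Real.exp (s / 2) ≤ Real.exp ((s + w) / 2) := by
      rw [add_div, Real.exp_add, mul_comm]
      exact mul_le_mul_of_nonneg_left (le_exp_half hw) (Real.exp_nonneg _)
    have h_one : 1 ≤ Real.exp ((s + w) / 2) := Real.one_le_exp (by positivity)
    refine add_le_add ?_ (le_mul_of_one_le_left (vecNorm_nonneg _) h_one)
    refine (mul_le_mul_of_nonneg_left ih hw).trans ?_
    rw [← mul_assoc]
    exact mul_le_mul_of_nonneg_right h_exp (Finset.sum_nonneg fun _ _ => vecNorm_nonneg _)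

theorem outputBias_le : θ.outputBias ≤ Real.exp (θ.pathNorm 0 / 2) * θ.biasNorm := by
  rw [outputBias, layerStart_eq, pathNorm_zero]
  exact θ.biasBound_le _

end Params

/-! ### Parameters that compute the Bellman-Ford distances -/

theorem relu_of_nonneg {n : ℕ} {y : Fin n → ℝ} (hy : 0 ≤ y) : relu y = y :=
  funext fun i => max_eq_right (hy i)

theorem pi_single_eq_const {ι : Type*} [DecidableEq ι] [Subsingleton ι] (i : ι) (y : ℝ) :
    (Pi.single i y : ι → ℝ) = fun _ => y :=
  funext fun j => by rw [Subsingleton.elim j i, Pi.single_eq_same]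

theorem single_mulVec_single {ι κ : Type*} [DecidableEq ι] [DecidableEq κ] [Fintype κ]
    (i : ι) (j : κ) (y : ℝ) : Matrix.single i j (1 : ℝ) *ᵥ Pi.single j y = Pi.single i y := by
  rw [Matrix.single_mulVec, Pi.single_eq_same, one_mul]
  rfl

theorem matNorm_single {ι κ : Type*} [Fintype ι] [Fintype κ] [DecidableEq ι] [DecidableEq κ]
    (i : ι) (j : κ) : matNorm (Matrix.single i j (1 : ℝ)) = 1 := by
  simp [matNorm, Matrix.single_apply, apply_ite abs, ite_and]

theorem vecNorm_single {ι : Type*} [Fintype ι] [DecidableEq ι] (i : ι) :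
    vecNorm (Pi.single i (1 : ℝ)) = 1 := by
  simp [vecNorm, Pi.single_apply, apply_ite abs]

theorem BFInstance.coe_dist_succ (G : BFInstance.{u}) (t : ℕ) (v : G.V) :
    (G.dist (t + 1) v : ℝ)
      = (G.nbrs v).inf' (G.nbrs_nonempty v) fun w => (G.dist t w : ℝ) + G.weight v w := by
  simp only [dist_succ, G.weight_comm v]
  exact Finset.apply_inf'_eq_inf'_comp _ NNReal.toReal NNReal.coe_mono.map_inf

instance neZero_dim [NeZero d] (j : ℕ) : NeZero (dim m K d j) :=
  ⟨by unfold dim; split_ifs; exacts [one_ne_zero, NeZero.ne d]⟩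

/-- Parameters with which the network computes the Bellman-Ford distances, in the first components
of the features. -/
def exactParams (m K d : ℕ) [NeZero d] : Params m K d where
  W _ := Matrix.single 0 0 1
  C _ := Pi.single 0 1
  b _ := 0

section ExactParams

variable [NeZero d]

theorem fnn_exactParams (s : ℕ) {y w : ℝ} (h_nonneg : 0 ≤ y + w) :
    ∀ (n : ℕ) (h : s + (n + 1) ≤ 2 * m * K),
    fnn (exactParams m K d) s (Pi.single 0 w) (n + 1) h (Pi.single 0 y) = Pi.single 0 (y + w)
  | 0, _ => by
    simp only [fnn, exactParams]
    rw [single_mulVec_single, ← Pi.single_add, add_zero]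
    exact relu_of_nonneg (Pi.single_nonneg.2 h_nonneg)
  | n + 1, h => by
    rw [fnn, fnn_exactParams s h_nonneg n (Nat.le_of_succ_le h)]
    simp only [exactParams]
    rw [add_zero]
    exact (congrArg relu (single_mulVec_single _ _ _)).trans
      (relu_of_nonneg (Pi.single_nonneg.2 h_nonneg))

theorem agg_exactParams (hm : 0 < m) (t : Fin K) (w y : ℝ≥0) :
    (exactParams m K d).agg t w (Pi.single 0 (y : ℝ)) = Pi.single 0 ((y : ℝ) + w) := by
  obtain ⟨n, rfl⟩ := Nat.exists_eq_succ_of_ne_zero hm.ne'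
  have h_edge : (w : ℝ) • (exactParams (n + 1) K d).C t = Pi.single 0 (w : ℝ) := by
    rw [exactParams, ← Pi.single_smul, smul_eq_mul, mul_one]
  rw [Params.agg, h_edge]
  exact fnn_exactParams _ (by positivity) n _

theorem upd_exactParams (hm : 0 < m) (t : Fin K) (y : ℝ≥0) :
    (exactParams m K d).upd t (Pi.single 0 (y : ℝ)) = Pi.single 0 (y : ℝ) := by
  obtain ⟨n, rfl⟩ := Nat.exists_eq_succ_of_ne_zero hm.ne'
  have h_fnn := fnn_exactParams (m := n + 1) (K := K) (d := d) (layerStart (n + 1) t + (n + 1))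
    (add_nonneg y.2 le_rfl) n (layerStart_succ_le t.isLt)
  rwa [Pi.single_zero, add_zero] at h_fnn

theorem feature_exactParams (hm : 0 < m) (G : BFInstance.{u}) (t : ℕ) (ht : t ≤ K) (v : G.V) :
    feature (exactParams m K d) G t ht v = Pi.single 0 (G.dist t v : ℝ) := by
  induction t generalizing v with
  | zero =>
    have : Subsingleton (Fin (dim m K d 0)) :=
      Fin.subsingleton_iff_le_one.2 (if_pos (Or.inl rfl)).le
    exact (pi_single_eq_const (ι := Fin (dim m K d 0)) 0 _).symm
  | succ t ih =>
    have := subsingleton_dim_aggregated (m := m) (d := d) ⟨t, ht⟩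
    have h_agg (w : G.V) (i : Fin (dim m K d (layerStart m t + m))) :
        (exactParams m K d).agg ⟨t, ht⟩ (G.weight v w)
          (feature (exactParams m K d) G t (Nat.le_of_succ_le ht) w) i
        = (G.dist t w : ℝ) + G.weight v w := by
      rw [ih, agg_exactParams hm ⟨t, ht⟩, pi_single_eq_const]
    have h_min (i : Fin (dim m K d (layerStart m t + m))) :=
      (Finset.inf'_congr (G.nbrs_nonempty v) rfl fun w _ => h_agg w i).trans
        (G.coe_dist_succ t v).symm
    refine (congrArg ((exactParams m K d).upd ⟨t, ht⟩) ?_).trans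
      (upd_exactParams hm ⟨t, ht⟩ (G.dist (t + 1) v))
    exact (funext h_min).trans (pi_single_eq_const 0 _).symm

theorem output_exactParams (hm : 0 < m) (G : BFInstance.{u}) (v : G.V) :
    output (exactParams m K d) G v = G.dist K v := by
  rw [output, feature_exactParams hm]
  exact Pi.single_eq_same (M := fun _ => ℝ) 0 _

theorem pathNorm_exactParams (k : Fin (K + 1)) :
    (exactParams m K d).pathNorm k = (activeLayers m K k).card := by
  have h_layer (j : ℕ) (hj : j ∈ activeLayers m K k) : (exactParams m K d).layerNorm k j = 1 := by
    rw [Params.layerNorm, Params.weightMatrix_of_lt _ (Finset.mem_Ico.1 hj).2]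
    split_ifs with h
    · cases k using Fin.cases with
      | zero => exact absurd h (Nat.succ_ne_zero j).symm
      | succ t =>
        obtain rfl : layerStart m t = j := Nat.succ_injective h
        rw [Params.edgeMatrix_layerStart_col]
        exact vecNorm_single _
    · exact matNorm_single _ _
  rw [Params.pathNorm, Finset.sum_congr rfl h_layer, Finset.sum_const, nsmul_one]

theorem biasNorm_exactParams : (exactParams m K d).biasNorm = 0 :=
  Finset.sum_eq_zero fun j hj => by
    rw [Params.biasVector_of_lt _ (Finset.mem_range.1 hj)]
    simp [exactParams, vecNorm]

theorem regLoss_exactParams (hm : 0 < m) :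
    regLoss (exactParams m K d) = m * (K ^ 2 + 3 * K) := by
  simp only [Params.regLoss_eq _ hm, pathNorm_exactParams, sum_card_activeLayers,
    biasNorm_exactParams, add_zero]

theorem loss_exactParams (hm : 0 < m) (X : Finset VertexInstance.{0}) (η : ℝ) :
    loss X η (exactParams m K d) = η * (m * (K ^ 2 + 3 * K)) := by
  simp [loss, empLoss, output_exactParams hm, regLoss_exactParams hm]

end ExactParams

/-! ### Parameters of almost minimal loss -/

theorem empLoss_nonneg (X : Finset VertexInstance.{0}) (θ : Params m K d) : 0 ≤ empLoss X θ :=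
  mul_nonneg (by positivity) (Finset.sum_nonneg fun _ _ => abs_nonneg _)

theorem card_mul_empLoss (X : Finset VertexInstance.{0}) (θ : Params m K d) :
    X.card * empLoss X θ = ∑ p ∈ X, |output θ p.1 p.2 - (p.1.dist K p.2 : ℝ)| := by
  obtain rfl | hX := X.eq_empty_or_nonempty
  · simp
  · rw [empLoss, ← mul_assoc, mul_one_div_cancel (Nat.cast_ne_zero.2 hX.card_pos.ne'), one_mul]

theorem succ_le_card_of_pathTrainingSet_subset {X : Finset VertexInstance.{0}} {x β : ℝ≥0}
    (hx : x ≠ 0) (hX : pathTrainingSet K β x ⊆ X) : K + 1 ≤ X.card := by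
  rw [← Fintype.card_fin (K + 1), ← Finset.card_univ]
  exact Finset.card_le_card_of_injOn _ (fun k _ => hX ⟨k, rfl⟩)
    (pathTrainingPair_injective β hx).injOn

namespace Params

variable (θ : Params m K d)

/-- The total amount by which the coefficients of the main term of the output fall short of `1`. -/
def coeffDefect : ℝ := ∑ k, max 0 (1 - θ.pathCoeff k)

theorem coeffDefect_nonneg : 0 ≤ θ.coeffDefect := Finset.sum_nonneg fun _ _ => le_max_left _ _

theorem max_one_sub_pathCoeff_le_coeffDefect (k : Fin (K + 1)) :
    max 0 (1 - θ.pathCoeff k) ≤ θ.coeffDefect :=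
  Finset.single_le_sum (f := fun k => max 0 (1 - θ.pathCoeff k)) (fun _ _ => le_max_left _ _)
    (Finset.mem_univ k)

theorem regLoss_nonneg (hm : 0 < m) : 0 ≤ regLoss θ := by
  rw [θ.regLoss_eq hm]
  exact add_nonneg (Finset.sum_nonneg fun k _ => θ.pathNorm_nonneg k) θ.biasNorm_nonneg

theorem outputBias_nonneg : 0 ≤ θ.outputBias := θ.biasBound_nonneg _

theorem mul_max_one_sub_pathCoeff_le (hm : 0 < m) {x β : ℝ≥0} (hβ : x ≤ β) (k : Fin (K + 1)) :
    x * max 0 (1 - θ.pathCoeff k)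
      ≤ |output θ (pathInstance K β (Pi.single k x)) (Fin.last K)
          - ((pathInstance K β (Pi.single k x)).dist K (Fin.last K) : ℝ)| + θ.outputBias := by
  have h_cost : (fun j => ((Pi.single k x : Fin (K + 1) → ℝ≥0) j : ℝ)) = Pi.single k (x : ℝ) := by
    funext j
    rw [Pi.single_apply, Pi.single_apply, apply_ite NNReal.toReal, NNReal.coe_zero]
  have h_output : output θ (pathInstance K β (Pi.single k x)) (Fin.last K)
      ≤ θ.pathCoeff k * x + θ.outputBias := by
    have h := θ.output_le hm _ (isWalk_pathInstance β (Pi.single k x))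
    rwa [walkCost_pathInstance, h_cost, dotProduct_single] at h
  have h_dist : (x : ℝ) ≤ (pathInstance K β (Pi.single k x)).dist K (Fin.last K) :=
    NNReal.coe_le_coe.2 (le_dist_pathInstance_single hβ k K)
  have h_abs := neg_le_abs (output θ (pathInstance K β (Pi.single k x)) (Fin.last K)
    - ((pathInstance K β (Pi.single k x)).dist K (Fin.last K) : ℝ))
  refine (mul_max_of_nonneg _ _ x.coe_nonneg).trans_le (max_le ?_ (by linarith))
  rw [mul_zero]
  exact add_nonneg (abs_nonneg _) θ.outputBias_nonneg

theorem mul_coeffDefect_le (hm : 0 < m) {X : Finset VertexInstance.{0}} {x β : ℝ≥0}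
    (hx : x ≠ 0) (hβ : x ≤ β) (hX : pathTrainingSet K β x ⊆ X) :
    x * θ.coeffDefect ≤ X.card * (empLoss X θ + θ.outputBias) := by
  classical
  have h_card : ((K + 1 : ℕ) : ℝ) ≤ X.card :=
    Nat.cast_le.2 (succ_le_card_of_pathTrainingSet_subset hx hX)
  have h_sub : (Finset.univ.image fun k : Fin (K + 1) =>
      (⟨pathInstance K β (Pi.single k x), Fin.last K⟩ : VertexInstance.{0})) ⊆ X :=
    Finset.image_subset_iff.2 fun k _ => hX ⟨k, rfl⟩
  calc x * θ.coeffDefect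
      = ∑ k, x * max 0 (1 - θ.pathCoeff k) := Finset.mul_sum _ _ _
    _ ≤ ∑ k, (|output θ (pathInstance K β (Pi.single k x)) (Fin.last K)
          - ((pathInstance K β (Pi.single k x)).dist K (Fin.last K) : ℝ)| + θ.outputBias) :=
        Finset.sum_le_sum fun k _ => θ.mul_max_one_sub_pathCoeff_le hm hβ k
    _ ≤ ∑ p ∈ X, |output θ p.1 p.2 - (p.1.dist K p.2 : ℝ)| + (K + 1 : ℕ) * θ.outputBias := by
        rw [Finset.sum_add_distrib, Finset.sum_const, Finset.card_univ, Fintype.card_fin,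
          nsmul_eq_mul, ← Finset.sum_image (f := fun p : VertexInstance.{0} =>
            |output θ p.1 p.2 - (p.1.dist K p.2 : ℝ)|) (pathTrainingPair_injective β hx).injOn]
        gcongr
    _ ≤ X.card * (empLoss X θ + θ.outputBias) := by
        rw [mul_add, card_mul_empLoss]
        gcongr
        exact θ.outputBias_nonneg

theorem sum_card_sub_pathNorm_le (hm : 0 < m) (hK : 0 < K) (s : Finset (Fin (K + 1))) :
    ∑ k ∈ s, ((activeLayers m K k).card - θ.pathNorm k) ≤ 3 * (m * K) * θ.coeffDefect := by
  refine (Finset.sum_le_sum fun k _ => θ.card_activeLayers_sub_pathNorm_le hm hK k).trans ?_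
  rw [← Finset.mul_sum]
  gcongr
  exact Finset.sum_le_univ_sum_of_nonneg fun k => le_max_left _ _

theorem sub_sum_pathNorm_le (hm : 0 < m) (hK : 0 < K) :
    m * (K ^ 2 + 3 * K) - ∑ k, θ.pathNorm k ≤ 3 * (m * K) * θ.coeffDefect := by
  rw [← sum_card_activeLayers, ← Finset.sum_sub_distrib]
  exact θ.sum_card_sub_pathNorm_le hm hK _

theorem pathNorm_sub_card_le (hm : 0 < m) (hK : 0 < K) (k : Fin (K + 1)) :
    θ.pathNorm k - (activeLayers m K k).card
      ≤ ∑ k, θ.pathNorm k - m * (K ^ 2 + 3 * K) + 3 * (m * K) * θ.coeffDefect := by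
  have h_others := θ.sum_card_sub_pathNorm_le hm hK (Finset.univ.erase k)
  have h_split := Finset.add_sum_erase Finset.univ
    (fun k : Fin (K + 1) => (activeLayers m K k).card - θ.pathNorm k) (Finset.mem_univ k)
  rw [Finset.sum_sub_distrib (s := Finset.univ), sum_card_activeLayers] at h_split
  linarith

theorem outputBias_le_half_mul_biasNorm (hm : 0 < m) {η : ℝ} {M : ℝ}
    (hη : 2 * Real.exp (M / 2) ≤ η) (h_reg : regLoss θ ≤ M) :
    θ.outputBias ≤ η / 2 * θ.biasNorm := by
  have h_single : θ.pathNorm 0 ≤ ∑ k, θ.pathNorm k :=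
    Finset.single_le_sum (fun k _ => θ.pathNorm_nonneg k) (Finset.mem_univ 0)
  rw [θ.regLoss_eq hm] at h_reg
  have h_exp : Real.exp (θ.pathNorm 0 / 2) ≤ Real.exp (M / 2) :=
    Real.exp_le_exp.2 (by linarith [θ.biasNorm_nonneg])
  exact θ.outputBias_le.trans (mul_le_mul_of_nonneg_right (by linarith) θ.biasNorm_nonneg)

section NearlyMinimal

variable {X : Finset VertexInstance.{0}} {η ε : ℝ}

theorem empLoss_add_biasNorm_le (hm : 0 < m) (hK : 0 < K) (hη : 0 ≤ η)
    (h_loss : loss X η θ ≤ η * (m * (K ^ 2 + 3 * K)) + ε)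
    (h_defect : 4 * (m * K) * η * θ.coeffDefect ≤ empLoss X θ + θ.outputBias)
    (h_bias : θ.outputBias ≤ η / 2 * θ.biasNorm) :
    empLoss X θ + 5 / 2 * (η * θ.biasNorm) ≤ 4 * ε := by
  rw [loss, θ.regLoss_eq hm] at h_loss
  linarith [mul_le_mul_of_nonneg_left (θ.sub_sum_pathNorm_le hm hK) hη]

theorem mul_pathNorm_sub_card_le (hm : 0 < m) (hK : 0 < K) (hη : 0 ≤ η)
    (h_loss : loss X η θ ≤ η * (m * (K ^ 2 + 3 * K)) + ε)
    (h_defect : 4 * (m * K) * η * θ.coeffDefect ≤ empLoss X θ + θ.outputBias)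
    (h_bias : θ.outputBias ≤ η / 2 * θ.biasNorm) (k : Fin (K + 1)) :
    η * (θ.pathNorm k - (activeLayers m K k).card) ≤ ε := by
  rw [loss, θ.regLoss_eq hm] at h_loss
  linarith [mul_le_mul_of_nonneg_left (θ.pathNorm_sub_card_le hm hK k) hη, empLoss_nonneg X θ,
    mul_nonneg hη θ.biasNorm_nonneg]

end NearlyMinimal

theorem pathGain_le_of_pathNorm_le (hm : 0 < m) {η ε : ℝ} (hη : 4 ≤ η) (hε₀ : 0 ≤ ε) (hε : ε ≤ 1)
    {k : Fin (K + 1)} (h_norm : η * (θ.pathNorm k - (activeLayers m K k).card) ≤ ε) :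
    θ.pathGain k ≤ 1 + ε / 2 := by
  have h_exponent : θ.pathNorm k - (activeLayers m K k).card ≤ ε / 4 := by
    by_contra! h
    nlinarith
  have h_abs : |ε / 4| = ε / 4 := abs_of_nonneg (by positivity)
  have h_exp := (le_abs_self _).trans (Real.abs_exp_sub_one_le (x := ε / 4) (by linarith))
  linarith [θ.pathGain_le_exp hm k, Real.exp_le_exp.2 h_exponent]

theorem one_sub_le_pathCoeff (hm : 0 < m) (hK : 0 < K) {η ε : ℝ} (hη : 4 ≤ η)
    (h_defect : 4 * (m * K) * η * θ.coeffDefect ≤ 4 * ε) (k : Fin (K + 1)) :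
    1 - ε / 4 ≤ θ.pathCoeff k := by
  have h_mK : (1 : ℝ) ≤ m * K := by exact_mod_cast Nat.mul_pos hm hK
  have h_factor : 4 * θ.coeffDefect ≤ m * K * η * θ.coeffDefect :=
    mul_le_mul_of_nonneg_right (by nlinarith) θ.coeffDefect_nonneg
  linarith [(le_max_right _ _).trans (θ.max_one_sub_pathCoeff_le_coeffDefect k)]

theorem abs_output_sub_dist_le (hm : 0 < m) {ε : ℝ} (hε : ε ≤ 1)
    (h_upper : ∀ k, θ.pathCoeff k ≤ 1 + ε)
    (h_lower : ∀ k, 1 - ε ≤ 2 * θ.pathCoeff k - θ.pathGain k) (h_bias : θ.outputBias ≤ ε)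
    (G : BFInstance.{u}) (v : G.V) :
    |output θ G v - (G.dist K v : ℝ)| ≤ ε * ((G.dist K v : ℝ) + 1) := by
  have hε₀ : 0 ≤ ε := θ.outputBias_nonneg.trans h_bias
  have h_le : output θ G v ≤ (1 + ε) * G.dist K v + ε := by
    obtain ⟨u, rfl, hu, h_cost⟩ := G.exists_sum_walkCost_le_dist K v
    have h_main : θ.pathCoeff ⬝ᵥ G.walkCost u ≤ (1 + ε) * ∑ k, G.walkCost u k := by
      rw [Finset.mul_sum]
      exact Finset.sum_le_sum fun k _ =>
        mul_le_mul_of_nonneg_right (h_upper k) (G.walkCost_nonneg u k)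
    have h_dist := mul_le_mul_of_nonneg_left h_cost (by linarith : 0 ≤ 1 + ε)
    linarith [θ.output_le hm G hu]
  have h_ge : (1 - ε) * G.dist K v - ε ≤ output θ G v := by
    obtain ⟨u, rfl, hu, h_output⟩ := θ.exists_le_output hm G v
    have h_main : (1 - ε) * ∑ k, G.walkCost u k
        ≤ 2 * θ.pathCoeff ⬝ᵥ G.walkCost u - θ.pathGain ⬝ᵥ G.walkCost u := by
      simp only [dotProduct, Finset.mul_sum, ← Finset.sum_sub_distrib, ← mul_assoc, ← sub_mul]
      exact Finset.sum_le_sum fun k _ =>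
        mul_le_mul_of_nonneg_right (h_lower k) (G.walkCost_nonneg u k)
    have h_dist := mul_le_mul_of_nonneg_left (G.dist_le_sum_walkCost hu) (sub_nonneg.2 hε)
    linarith
  rw [abs_le]
  constructor <;> linarith

end Params

theorem bddBelow_range_loss (hm : 0 < m) (X : Finset VertexInstance.{0}) {η : ℝ} (hη : 0 ≤ η) :
    BddBelow (Set.range fun θ : Params m K d => loss X η θ) :=
  ⟨0, Set.forall_mem_range.2 fun θ =>
    add_nonneg (empLoss_nonneg X θ) (mul_nonneg hη (θ.regLoss_nonneg hm))⟩

theorem regLoss_le_of_loss_le {X : Finset VertexInstance.{0}} {η ε M : ℝ} {θ : Params m K d}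
    (hη : 1 ≤ η) (hε : ε ≤ 1) (h_loss : loss X η θ ≤ η * M + ε) : regLoss θ ≤ M + 1 := by
  have h_emp := empLoss_nonneg X θ
  rw [loss] at h_loss
  by_contra! h
  nlinarith

theorem iInf_loss_le [NeZero d] (hm : 0 < m) (X : Finset VertexInstance.{0}) {η : ℝ} (hη : 0 ≤ η) :
    ⨅ θ : Params m K d, loss X η θ ≤ η * (m * (K ^ 2 + 3 * K)) :=
  (ciInf_le (bddBelow_range_loss hm X hη) (exactParams m K d)).trans_eq (loss_exactParams hm X η)

theorem nonneg_of_loss_le_iInf_add (hm : 0 < m) {X : Finset VertexInstance.{0}} {η ε : ℝ}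
    (hη : 0 ≤ η) {θ : Params m K d} (hθ : loss X η θ ≤ (⨅ θ' : Params m K d, loss X η θ') + ε) :
    0 ≤ ε := by
  linarith [ciInf_le (bddBelow_range_loss hm X hη) θ]

theorem one_le_mul_sq_add_three_mul (hK : 0 < K) (hm : 0 < m) :
    (1 : ℝ) ≤ m * (K ^ 2 + 3 * K) := by
  exact_mod_cast Nat.one_le_iff_ne_zero.2 (by positivity)

theorem four_le_of_two_mul_exp_le (hK : 0 < K) (hm : 0 < m) {η : ℝ}
    (hη : 2 * Real.exp ((m * (K ^ 2 + 3 * K) + 1) / 2) ≤ η) : 4 ≤ η := by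
  linarith [Real.add_one_le_exp (((m : ℝ) * (K ^ 2 + 3 * K) + 1) / 2),
    one_le_mul_sq_add_three_mul hK hm]

theorem Params.four_mul_coeffDefect_le (θ : Params m K d) (hm : 0 < m) (hK : 0 < K)
    {X : Finset VertexInstance.{0}} {η : ℝ} {x β : ℝ≥0} (hη : 0 < η)
    (hx : 4 * (m : ℝ) * K * X.card * η ≤ x) (hβ : x ≤ β) (hX : pathTrainingSet K β x ⊆ X) :
    4 * (m * K) * η * θ.coeffDefect ≤ empLoss X θ + θ.outputBias := by
  have h_card : (0 : ℝ) < X.card := Nat.cast_pos.2 (Finset.card_pos.2 ⟨_, hX ⟨0, rfl⟩⟩)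
  have h_x : (0 : ℝ) < x := lt_of_lt_of_le (by positivity) hx
  refine le_of_mul_le_mul_left ?_ h_card
  calc X.card * (4 * (m * K) * η * θ.coeffDefect)
      = 4 * m * K * X.card * η * θ.coeffDefect := by ring
    _ ≤ x * θ.coeffDefect := mul_le_mul_of_nonneg_right hx θ.coeffDefect_nonneg
    _ ≤ X.card * (empLoss X θ + θ.outputBias) :=
        θ.mul_coeffDefect_le hm (NNReal.coe_pos.1 h_x).ne' hβ hX

theorem two_mul_exp_half_le (hK : 1 ≤ K) (hm : 1 ≤ m) :
    2 * Real.exp ((m * (K ^ 2 + 3 * K) + 1) / 2)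
      ≤ 2 * (K : ℝ) * Real.exp (m * (K ^ 2 + 3 * K)) := by
  have h_exponent := one_le_mul_sq_add_three_mul hK hm
  have h_K : (1 : ℝ) ≤ K := Nat.one_le_cast.2 hK
  exact mul_le_mul (by linarith) (Real.exp_le_exp.2 (by linarith)) (Real.exp_pos _).le (by linarith)

end BFLearning

open BFLearning in
theorem mainTheorem1_general (K m d : ℕ) (hK : 1 ≤ K) (hm : 1 ≤ m) (hd : 1 ≤ d)
    (X : Finset VertexInstance.{0}) (η : ℝ) (x β : ℝ≥0)
    (hη : 2 * Real.exp ((m * (K ^ 2 + 3 * K) + 1) / 2) ≤ η)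
    (hx : 4 * (m : ℝ) * K * X.card * η ≤ x) (hβ : x ≤ β)
    (hX : pathTrainingSet K β x ⊆ X) (ε : ℝ) (hε : ε ≤ 1) (θ : Params m K d)
    (hθ : loss X η θ ≤ (⨅ θ' : Params m K d, loss X η θ') + ε) (G : BFInstance.{u}) (v : G.V) :
    |output θ G v - (G.dist K v : ℝ)| ≤ ε * ((G.dist K v : ℝ) + 1) := by
  have : NeZero d := ⟨Nat.one_le_iff_ne_zero.1 hd⟩
  have hη₄ : 4 ≤ η := four_le_of_two_mul_exp_le hK hm hη
  have hη₀ : 0 < η := by linarith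
  have hε₀ : 0 ≤ ε := nonneg_of_loss_le_iInf_add hm hη₀.le hθ
  have h_loss := hθ.trans (add_le_add_left (iInf_loss_le hm X hη₀.le) ε)
  have h_reg := regLoss_le_of_loss_le (by linarith) hε h_loss
  have h_bias := θ.outputBias_le_half_mul_biasNorm hm hη h_reg
  have h_defect := θ.four_mul_coeffDefect_le hm hK hη₀ hx hβ hX
  have h_energy := θ.empLoss_add_biasNorm_le hm hK hη₀.le h_loss h_defect h_bias
  have h_gain (k) : θ.pathGain k ≤ 1 + ε / 2 := θ.pathGain_le_of_pathNorm_le hm hη₄ hε₀ hε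
    (θ.mul_pathNorm_sub_card_le hm hK hη₀.le h_loss h_defect h_bias k)
  have h_bias_nonneg := mul_nonneg hη₀.le θ.biasNorm_nonneg
  have h_coeff (k) : 1 - ε / 4 ≤ θ.pathCoeff k :=
    θ.one_sub_le_pathCoeff hm hK hη₄ (by linarith) k
  refine θ.abs_output_sub_dist_le hm hε (fun k => ?_) (fun k => ?_) ?_ G v
  · linarith [θ.pathCoeff_le_pathGain k, h_gain k]
  · linarith [h_gain k, h_coeff k]
  · linarith [empLoss_nonneg X θ]

theorem mainTheorem1 (K m d : ℕ) (hK : 1 ≤ K) (hm : 1 ≤ m) (hd : 1 ≤ d)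
    (X : Finset BFLearning.VertexInstance.{0}) (η : ℝ) (x β : ℝ≥0)
    (hη : 2 * (K : ℝ) * Real.exp ((m : ℝ) * ((K : ℝ) ^ 2 + 3 * (K : ℝ))) ≤ η)
    (hx : 4 * (m : ℝ) * (K : ℝ) * (X.card : ℝ) * η ≤ (x : ℝ))
    (hβ : 2 * ((X.card : ℝ) + (x : ℝ) + 1) ≤ (β : ℝ))
    (hX : BFLearning.pathTrainingSet K β x ⊆ (X : Set BFLearning.VertexInstance.{0}))
    (ε : ℝ) (hε : ε ≤ 1 / 2)
    (θ : BFLearning.Params m K d)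
    (hθ : BFLearning.loss X η θ ≤ (⨅ θ' : BFLearning.Params m K d, BFLearning.loss X η θ') + ε)
    (G : BFLearning.BFInstance.{u}) (v : G.V) :
    |BFLearning.output θ G v - (G.dist K v : ℝ)| ≤ ε * ((G.dist K v : ℝ) + 1) := by
  have h_le : x ≤ β :=
    NNReal.coe_le_coe.1 (by linarith [x.coe_nonneg, X.card.cast_nonneg (α := ℝ)])
  exact mainTheorem1_general K m d hK hm hd X η x β
    ((BFLearning.two_mul_exp_half_le hK hm).trans hη) hx h_le hX ε (by linarith) θ hθ G v
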